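/- Let $F:\mathbb{R}^n\to\mathbb{R}^n$ be real analytic, and suppose that for every $x_0\in\mathbb{R}^n$ the equation $\dot x=F(x)$, $x(0)=x_0$, has a unique solution $S^t(x_0)$ for all $t\ge 0$. Let $x^*$ be an asymptotically stable equilibrium point with basin of attraction $\mathcal{B}=\{x: S^t(x)\to x^* \text{ as } t\to\infty\}$, and suppose that the Jacobian matrix of $F$ at $x^*$ has $n$ distinct eigenvalues $\lambda_1,\dots,\lambda_n\in\mathbb{C}$ with $\mathrm{Re}\,\lambda_j<0$ which are non-resonant: $\lambda_j\neq m_1\lambda_1+\dots+m_n\lambda_n$ for all $j$ and all $m\in\mathbb{N}_0^n$ with $m_1+\dots+m_n\ge 2$. Let $\phi_1,\dots,\phi_n:\mathcal{B}\to\mathbb{C}$ be principal Koopman eigenfunctions: $\phi_j$ is not identically zero, smooth on $\mathcal{B}$, analytic in a neighbourhood of $x^*$, and $\phi_j\circ S^t=e^{\lambda_j t}\phi_j$ on $\mathcal{B}$ for all $t\ge0$. Put $h=(\phi_1,\dots,\phi_n):\mathcal{B}\to\mathbb{C}^n$, and let $\mathcal{S}_h$ be the modulated Segal–Bargmann space of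 the functions $f=g\circ h$ on $\mathcal{B}$, with $g:\mathbb{C}^n\to\mathbb{C}$ entire and $$\|f\|^2=\frac1{\pi^n}\int_{\mathbb{C}^n}|g(z)|^2e^{-|z|^2}\,dz<\infty,\qquad \langle f_1,f_2\rangle=\frac1{\pi^n}\int_{\mathbb{C}^n}g_1(z)\overline{g_2(z)}\,e^{-|z|^2}\,dz .$$ Then each $f\in\mathcal{S}_h$ is $g\circ h$ for only one such $g$, and $\mathcal{S}_h$ is a Hilbert space. For $k\in\mathbb{N}_0^n$ let $P_k$ be the orthogonal projection of $\mathcal{S}_h$ onto the line spanned by $\phi^k=\phi_1^{k_1}\cdots\phi_n^{k_n}$. The monomials $\phi^k$ are pairwise orthogonal, and every $f\in\mathcal{S}_h$ has an expansion $f=\sum_k V_k\phi^k$, convergent in $\mathcal{S}_h$ and pointwise on $\mathcal{B}$, with $P_kf=V_k\phi^k$. The Koopman operators $U^tf=f\circ S^t$, $t\ge0$, are bounded on $\mathcal{S}_h$ and form a strongly continuous semigroup; let $L$ be its infinitesimal generator and $R(s;L)=(sI-L)^{-1}$ its resolvent. The half-plane $\{\mathrm{Re}\,s>0\}$ is contained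 in the resolvent set of $L$, and for every $s$ in the resolvent set $$R(s;L)f=\sum_{k\in\mathbb{N}_0^n}\frac{P_kf}{s-(k_1\lambda_1+\dots+k_n\lambda_n)}\qquad (f\in\mathcal{S}_h),$$ where no denominator vanishes and the series converges unconditionally in $\mathcal{S}_h$. The region of convergence of the Laplace integral $\int_0^\infty e^{-st}U^t\,dt$, i.e. the set of $s\in\mathbb{C}$ for which $\int_0^Te^{-st}U^tf\,dt$ converges in $\mathcal{S}_h$ as $T\to\infty$ for every $f\in\mathcal{S}_h$, is exactly $\{s:\mathrm{Re}\,s>0\}$, and there the integral equals $R(s;L)f$. -/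

import Mathlib

open MeasureTheory Filter Set
open scoped Topology ContDiff ComplexConjugate

noncomputable section

namespace KoopmanResolvent

/-! ### The dynamical system -/

/-- `S` is the (forward) flow of `x' = F x` on `ℝⁿ`: for every initial condition the solution exists
for all `t ≥ 0`, is unique, and is `t ↦ S t x`. The values `S t x` with `t < 0` are irrelevant. -/
structure IsFlow {n : ℕ} (F : (Fin n → ℝ) → (Fin n → ℝ))
    (S : ℝ → (Fin n → ℝ) → (Fin n → ℝ)) : Prop where
  init : ∀ x, S 0 x = x
  ode : ∀ x, ∀ t : ℝ, 0 ≤ t →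
    HasDerivWithinAt (fun τ => S τ x) (F (S t x)) (Ici 0) t
  unique : ∀ (x : Fin n → ℝ) (y : ℝ → Fin n → ℝ), y 0 = x →
    (∀ t : ℝ, 0 ≤ t → HasDerivWithinAt y (F (y t)) (Ici 0) t) →
    ∀ t : ℝ, 0 ≤ t → y t = S t x

/-- The basin of attraction of `xs`. -/
def basin {n : ℕ} (S : ℝ → (Fin n → ℝ) → (Fin n → ℝ)) (xs : Fin n → ℝ) : Set (Fin n → ℝ) :=
  {x | Tendsto (fun t => S t x) atTop (𝓝 xs)}

/-- `xs` is an (asymptotically) stable equilibrium point: it is an equilibrium, it is stable in the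
sense of Lyapunov, and its basin of attraction is a neighbourhood of it. -/
structure IsStableEquilibrium {n : ℕ} (F : (Fin n → ℝ) → (Fin n → ℝ))
    (S : ℝ → (Fin n → ℝ) → (Fin n → ℝ)) (xs : Fin n → ℝ) : Prop where
  equilibrium : F xs = 0
  stable : ∀ U ∈ 𝓝 xs, ∃ V ∈ 𝓝 xs, ∀ x ∈ V, ∀ t : ℝ, 0 ≤ t → S t x ∈ U
  attractive : basin S xs ∈ 𝓝 xs

/-- The Jacobian matrix of `F` at `x`. -/
def jacobian {n : ℕ} (F : (Fin n → ℝ) → (Fin n → ℝ)) (x : Fin n → ℝ) :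
    Matrix (Fin n) (Fin n) ℝ :=
  LinearMap.toMatrix' (fderiv ℝ F x : (Fin n → ℝ) →ₗ[ℝ] (Fin n → ℝ))

/-- `μ` is an eigenvalue of the Jacobian matrix of `F` at `x`, over the complex numbers. -/
def IsJacobianEigenvalue {n : ℕ} (F : (Fin n → ℝ) → (Fin n → ℝ)) (x : Fin n → ℝ) (μ : ℂ) : Prop :=
  Module.End.HasEigenvalue
    (Matrix.toLin' ((jacobian F x).map (fun a : ℝ => (a : ℂ)))) μ

/-- The combination `k₁ λ₁ + ⋯ + kₙ λₙ`. -/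
def lincomb {n : ℕ} (lam : Fin n → ℂ) (k : Fin n → ℕ) : ℂ := ∑ i, (k i : ℂ) * lam i

/-- Non-resonance (in the sense of Poincaré): no `λ_j` is equal to `m₁ λ₁ + ⋯ + mₙ λₙ` with
natural numbers `m_i` such that `m₁ + ⋯ + mₙ ≥ 2`. -/
def NonResonant {n : ℕ} (lam : Fin n → ℂ) : Prop :=
  ∀ (j : Fin n) (m : Fin n → ℕ), 2 ≤ ∑ i, m i → lam j ≠ lincomb lam m

/-- `φ` is a principal Koopman eigenfunction on the basin of `xs` for the eigenvalue `μ`: it is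
nonzero, `φ ∘ S^t = e^{μ t} φ` on the basin for `t ≥ 0`, it is smooth on the basin, and it is
analytic in some neighbourhood of `xs`. -/
structure IsPrincipalEigenfunction {n : ℕ} (S : ℝ → (Fin n → ℝ) → (Fin n → ℝ))
    (xs : Fin n → ℝ) (μ : ℂ) (φ : (Fin n → ℝ) → ℂ) : Prop where
  nonzero : ∃ x ∈ basin S xs, φ x ≠ 0
  eigen : ∀ x ∈ basin S xs, ∀ t : ℝ, 0 ≤ t → φ (S t x) = Complex.exp (μ * t) * φ x
  smooth : ContDiffOn ℝ ∞ φ (basin S xs)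
  analytic : AnalyticAt ℝ φ xs

theorem IsFlow.add {n : ℕ} {F : (Fin n → ℝ) → (Fin n → ℝ)}
    {S : ℝ → (Fin n → ℝ) → (Fin n → ℝ)} (hS : IsFlow F S) (x : Fin n → ℝ) {s t : ℝ}
    (hs : 0 ≤ s) (ht : 0 ≤ t) : S (s + t) x = S s (S t x) := by
  refine hS.unique (S t x) (fun r => S (r + t) x) (by simp) (fun r hr => ?_) s hs
  have h := hS.ode x (r + t) (by positivity)
  have h2 : HasDerivWithinAt (fun r : ℝ => r + t) 1 (Ici 0) r :=
    ((hasDerivAt_id r).add_const t).hasDerivWithinAt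
  have h3 := HasDerivWithinAt.scomp (g₁ := fun τ => S τ x) (t' := Ici 0) r h h2
    (fun u hu => by simp only [mem_Ici] at hu ⊢; linarith)
  simpa [Function.comp_def] using h3

theorem IsFlow.mem_basin {n : ℕ} {F : (Fin n → ℝ) → (Fin n → ℝ)}
    {S : ℝ → (Fin n → ℝ) → (Fin n → ℝ)} (hS : IsFlow F S) {xs x : Fin n → ℝ}
    (hx : x ∈ basin S xs) {t : ℝ} (ht : 0 ≤ t) : S t x ∈ basin S xs := by
  have h1 : Tendsto (fun s : ℝ => S (s + t) x) atTop (𝓝 xs) :=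
    Tendsto.comp (g := fun τ => S τ x) hx (tendsto_atTop_add_const_right _ t tendsto_id)
  refine h1.congr' ?_
  filter_upwards [eventually_ge_atTop 0] with s hs
  exact hS.add x hs ht

/-- The flow restricted to the basin of attraction. -/
def flowOnBasin {n : ℕ} {F : (Fin n → ℝ) → (Fin n → ℝ)}
    {S : ℝ → (Fin n → ℝ) → (Fin n → ℝ)} (hS : IsFlow F S) (xs : Fin n → ℝ)
    (t : ℝ) (ht : 0 ≤ t) (x : basin S xs) : basin S xs :=
  ⟨S t x, hS.mem_basin x.2 ht⟩

/-! ### The Segal–Bargmann space -/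

/-- The weight `π⁻ⁿ exp (-|z|²)` on `ℂⁿ`. -/
def weight (n : ℕ) (z : Fin n → ℂ) : ℝ := (Real.pi ^ n)⁻¹ * Real.exp (-∑ i, ‖z i‖ ^ 2)

theorem weight_pos (n : ℕ) (z : Fin n → ℂ) : 0 < weight n z := by
  unfold weight; positivity

theorem continuous_weight (n : ℕ) : Continuous (weight n) := by
  unfold weight; fun_prop

theorem integrable_conj_mul {n : ℕ} {f g : (Fin n → ℂ) → ℂ}
    (hf : Continuous f) (hg : Continuous g)
    (hf2 : Integrable (fun z => ‖f z‖ ^ 2 * weight n z))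
    (hg2 : Integrable (fun z => ‖g z‖ ^ 2 * weight n z)) :
    Integrable (fun z => conj (f z) * g z * (weight n z : ℂ)) := by
  have hc := continuous_weight n
  refine (hf2.add hg2).mono' (by fun_prop) (Eventually.of_forall fun z => ?_)
  have hw := weight_pos n z
  simp only [norm_mul, RCLike.norm_conj, Complex.norm_real, Real.norm_eq_abs, abs_of_pos hw,
    Pi.add_apply]
  nlinarith [sq_nonneg (‖f z‖ - ‖g z‖), norm_nonneg (f z), norm_nonneg (g z),
    mul_nonneg (sq_nonneg (‖f z‖ - ‖g z‖)) hw.le, mul_nonneg (sq_nonneg (‖f z‖)) hw.le,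
    mul_nonneg (sq_nonneg (‖g z‖)) hw.le]

/-- The entire functions on `ℂⁿ` that are square integrable for the weight `π⁻ⁿ exp (-|z|²)`. -/
def fockSubmodule (n : ℕ) : Submodule ℂ ((Fin n → ℂ) → ℂ) where
  carrier := {g | Differentiable ℂ g ∧ Integrable (fun z => ‖g z‖ ^ 2 * weight n z)}
  zero_mem' := ⟨differentiable_const 0, by simp⟩
  add_mem' := by
    rintro f g ⟨hf, hf2⟩ ⟨hg, hg2⟩
    refine ⟨hf.add hg, ?_⟩
    have hc := continuous_weight n
    have hfc := hf.continuous
    have hgc := hg.continuous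
    refine ((hf2.add hg2).const_mul 2).mono'
      (Continuous.aestronglyMeasurable (((hfc.add hgc).norm.pow 2).mul hc))
      (Eventually.of_forall fun z => ?_)
    have hw := weight_pos n z
    rw [Real.norm_of_nonneg (by positivity)]
    simp only [Pi.add_apply]
    have h1 : ‖f z + g z‖ ^ 2 ≤ 2 * (‖f z‖ ^ 2 + ‖g z‖ ^ 2) := by
      have h0 : ‖f z + g z‖ ^ 2 ≤ (‖f z‖ + ‖g z‖) ^ 2 :=
        pow_le_pow_left₀ (norm_nonneg _) (norm_add_le _ _) 2
      nlinarith [sq_nonneg (‖f z‖ - ‖g z‖)]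
    nlinarith
  smul_mem' := by
    rintro c g ⟨hg, hg2⟩
    refine ⟨hg.const_smul c, ?_⟩
    refine (hg2.const_mul (‖c‖ ^ 2)).congr (Eventually.of_forall fun z => ?_)
    simp [mul_pow, mul_assoc]

/-- The Segal–Bargmann space of `ℂⁿ`. -/
def FockSpace (n : ℕ) : Type := ↥(fockSubmodule n)

namespace FockSpace

instance (n : ℕ) : AddCommGroup (FockSpace n) := inferInstanceAs (AddCommGroup ↥(fockSubmodule n))

instance (n : ℕ) : Module ℂ (FockSpace n) := inferInstanceAs (Module ℂ ↥(fockSubmodule n))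

/-- An element of the Segal–Bargmann space as a function on `ℂⁿ`. -/
def toFunₗ (n : ℕ) : FockSpace n →ₗ[ℂ] ((Fin n → ℂ) → ℂ) := (fockSubmodule n).subtype

instance (n : ℕ) : CoeFun (FockSpace n) (fun _ => (Fin n → ℂ) → ℂ) := ⟨fun g => toFunₗ n g⟩

theorem differentiable {n : ℕ} (g : FockSpace n) : Differentiable ℂ (g : (Fin n → ℂ) → ℂ) := g.2.1

theorem integrable_sq {n : ℕ} (g : FockSpace n) :
    Integrable (fun z => ‖g z‖ ^ 2 * weight n z) := g.2.2

theorem integrable_inner {n : ℕ} (f g : FockSpace n) :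
    Integrable (fun z => conj (f z) * g z * (weight n z : ℂ)) :=
  integrable_conj_mul f.differentiable.continuous g.differentiable.continuous
    f.integrable_sq g.integrable_sq

theorem integral_self {n : ℕ} (f : FockSpace n) :
    ∫ z, conj (f z) * f z * (weight n z : ℂ) = ((∫ z, ‖f z‖ ^ 2 * weight n z : ℝ) : ℂ) := by
  rw [← integral_complex_ofReal]
  congr 1
  ext z
  rw [Complex.conj_mul']
  push_cast
  rfl

/-- The inner product `π⁻ⁿ ∫ conj (g₁ z) g₂ z exp (-|z|²) dz` (conjugate-linear in the first
argument). -/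
abbrev core (n : ℕ) : InnerProductSpace.Core ℂ (FockSpace n) where
  inner f g := ∫ z, conj (f z) * g z * (weight n z : ℂ)
  conj_inner_symm f g := by
    rw [← integral_conj]
    congr 1
    ext z
    simp only [map_mul, Complex.conj_conj, Complex.conj_ofReal]
    ring
  re_inner_nonneg f := by
    rw [integral_self]
    simp only [RCLike.re_to_complex, Complex.ofReal_re]
    exact integral_nonneg fun z => mul_nonneg (sq_nonneg _) (weight_pos n z).le
  add_left f g h := by
    rw [← integral_add (integrable_inner f h) (integrable_inner g h)]
    congr 1
    ext z
    simp only [map_add, Pi.add_apply]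
    ring
  smul_left f g r := by
    rw [← integral_const_mul]
    congr 1
    ext z
    simp only [map_smul, Pi.smul_apply, smul_eq_mul, map_mul]
    ring
  definite f hf := by
    rw [integral_self, Complex.ofReal_eq_zero] at hf
    have hc := continuous_weight n
    have hfc := f.differentiable.continuous
    have h0 : Continuous (fun z => ‖f z‖ ^ 2 * weight n z) := by fun_prop
    rw [integral_eq_zero_iff_of_nonneg
      (fun z => mul_nonneg (sq_nonneg _) (weight_pos n z).le) f.integrable_sq] at hf
    have hf' := (h0.ae_eq_iff_eq volume (continuous_const (y := (0 : ℝ)))).1 hf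
    refine Subtype.ext (funext fun z => ?_)
    have := congrFun hf' z
    have h1 : toFunₗ n f z = 0 := by simpa [(weight_pos n z).ne'] using this
    exact h1

instance (n : ℕ) : NormedAddCommGroup (FockSpace n) :=
  InnerProductSpace.Core.toNormedAddCommGroup (cd := core n)

instance (n : ℕ) : InnerProductSpace ℂ (FockSpace n) :=
  InnerProductSpace.ofCore (core n).toCore

end FockSpace

/-! ### The modulated Segal–Bargmann space -/

/-- Composition `g ↦ g ∘ h` from the Segal–Bargmann space to functions on `X`. -/
def compMap {X : Type*} {n : ℕ} (h : X → Fin n → ℂ) : FockSpace n →ₗ[ℂ] (X → ℂ) :=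
  (LinearMap.funLeft ℂ ℂ h).comp (FockSpace.toFunₗ n)

/-- The modulated Segal–Bargmann space `S_h`: the functions on `X` of the form `g ∘ h` with `g` in
the Segal–Bargmann space. The proof `hh` that `g` is determined by `g ∘ h` is carried along in order
to define the inner product below. -/
def ModulatedSB {X : Type*} {n : ℕ} {h : X → Fin n → ℂ}
    (_hh : Function.Injective (compMap h)) : Type _ := ↥(LinearMap.range (compMap h))

namespace ModulatedSB

variable {X : Type*} {n : ℕ} {h : X → Fin n → ℂ} (hh : Function.Injective (compMap h))

instance : AddCommGroup (ModulatedSB hh) :=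
  inferInstanceAs (AddCommGroup ↥(LinearMap.range (compMap h)))

instance : Module ℂ (ModulatedSB hh) :=
  inferInstanceAs (Module ℂ ↥(LinearMap.range (compMap h)))

/-- An element of `S_h` as a function on `X`. -/
def toFunₗ : ModulatedSB hh →ₗ[ℂ] (X → ℂ) := (LinearMap.range (compMap h)).subtype

instance : CoeFun (ModulatedSB hh) (fun _ => X → ℂ) := ⟨fun f => toFunₗ hh f⟩

/-- The linear bijection `g ↦ g ∘ h`. -/
def equiv : FockSpace n ≃ₗ[ℂ] ModulatedSB hh := LinearEquiv.ofInjective (compMap h) hh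

theorem equiv_apply (g : FockSpace n) (x : X) : (equiv hh g) x = g (h x) := rfl

/-- The norm of `g ∘ h` is the norm of `g`. -/
instance : NormedAddCommGroup (ModulatedSB hh) :=
  NormedAddCommGroup.induced _ _ (equiv hh).symm.toLinearMap (equiv hh).symm.injective

/-- The inner product of `g₁ ∘ h` and `g₂ ∘ h` is the inner product of `g₁` and `g₂`. -/
instance : InnerProductSpace ℂ (ModulatedSB hh) :=
  InnerProductSpace.induced (equiv hh).symm.toLinearMap

theorem inner_equiv (g₁ g₂ : FockSpace n) :
    inner ℂ (equiv hh g₁) (equiv hh g₂) = ∫ z, conj (g₁ z) * g₂ z * (weight n z : ℂ) := by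
  change inner ℂ ((equiv hh).symm (equiv hh g₁)) ((equiv hh).symm (equiv hh g₂)) = _
  simp only [LinearEquiv.symm_apply_apply]
  rfl

end ModulatedSB

/-! ### Monomials and the projections onto them -/

theorem integrable_pow_mul_exp (m : ℕ) :
    Integrable (fun z : ℂ => ‖z‖ ^ (2 * m) * Real.exp (-‖z‖ ^ 2)) := by
  have h := Complex.integral_rpow_mul_exp_neg_rpow (p := 2) (q := ((2 * m : ℕ) : ℝ)) (by norm_num)
    (by have : (0 : ℝ) ≤ ((2 * m : ℕ) : ℝ) := by positivity
        linarith)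
  have h2 : Integrable (fun z : ℂ => ‖z‖ ^ (((2 * m : ℕ) : ℝ)) * Real.exp (-‖z‖ ^ (2 : ℝ))) := by
    by_contra hc
    rw [integral_undef hc] at h
    have h3 : 0 < Real.Gamma ((((2 * m : ℕ) : ℝ) + 2) / 2) := Real.Gamma_pos_of_pos (by positivity)
    have := Real.pi_pos
    have h4 : 0 < 2 * Real.pi / 2 * Real.Gamma ((((2 * m : ℕ) : ℝ) + 2) / 2) := by positivity
    linarith
  refine h2.congr (Eventually.of_forall fun z => ?_)
  simp only [Real.rpow_natCast, Real.rpow_two]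

/-- The monomial `z₁^k₁ ⋯ zₙ^kₙ` in the Segal–Bargmann space. -/
def fockMonomial {n : ℕ} (k : Fin n → ℕ) : FockSpace n :=
  ⟨fun z => ∏ i, z i ^ k i, by fun_prop, by
    have h : Integrable (fun z : Fin n → ℂ => ∏ i, (‖z i‖ ^ (2 * k i) * Real.exp (-‖z i‖ ^ 2))) :=
      Integrable.fintype_prod (f := fun i (w : ℂ) => ‖w‖ ^ (2 * k i) * Real.exp (-‖w‖ ^ 2))
        (fun i => integrable_pow_mul_exp (k i))
    refine (h.const_mul (Real.pi ^ n)⁻¹).congr (Eventually.of_forall fun z => ?_)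
    simp only [weight, norm_prod, norm_pow, Finset.prod_mul_distrib, ← Finset.prod_pow,
      ← Finset.sum_neg_distrib, Real.exp_sum, ← pow_mul, mul_comm 2]
    ring⟩

/-- The monomial `h₁^k₁ ⋯ hₙ^kₙ` in `S_h`. -/
def monomial {X : Type*} {n : ℕ} {h : X → Fin n → ℂ} (hh : Function.Injective (compMap h))
    (k : Fin n → ℕ) : ModulatedSB hh :=
  ModulatedSB.equiv hh (fockMonomial k)

theorem monomial_apply {X : Type*} {n : ℕ} {h : X → Fin n → ℂ}
    (hh : Function.Injective (compMap h)) (k : Fin n → ℕ) (x : X) :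
    monomial hh k x = ∏ i, h x i ^ k i := rfl

/-- The orthogonal projection `P_k` of `S_h` onto the line spanned by `h₁^k₁ ⋯ hₙ^kₙ`. -/
def proj {X : Type*} {n : ℕ} {h : X → Fin n → ℂ} (hh : Function.Injective (compMap h))
    (k : Fin n → ℕ) : ModulatedSB hh →L[ℂ] ModulatedSB hh :=
  (Submodule.span ℂ {monomial hh k}).starProjection

/-! ### Semigroups, generators, resolvents, Laplace transforms -/

section Semigroup

variable {E : Type*} [NormedAddCommGroup E] [NormedSpace ℂ E]

/-- `l` is the strong limit of `(U^t f - f) / t` as `t ↓ 0`. -/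
def GeneratesAt (U : ℝ → E →L[ℂ] E) (f l : E) : Prop :=
  Tendsto (fun t : ℝ => ((t⁻¹ : ℝ) : ℂ) • (U t f - f)) (𝓝[>] 0) (𝓝 l)

/-- The domain of the infinitesimal generator: the limit of `(U^t f - f) / t` exists. -/
def generatorDomain (U : ℝ → E →L[ℂ] E) : Submodule ℂ E where
  carrier := {f | ∃ l, GeneratesAt U f l}
  zero_mem' := ⟨0, by simp [GeneratesAt]⟩
  add_mem' := by
    rintro f g ⟨l, hl⟩ ⟨m, hm⟩
    refine ⟨l + m, (Tendsto.add hl hm).congr fun t => ?_⟩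
    rw [← smul_add, map_add]
    congr 1
    abel
  smul_mem' := by
    rintro c f ⟨l, hl⟩
    refine ⟨c • l, (Tendsto.const_smul hl c).congr fun t => ?_⟩
    rw [map_smul, ← smul_sub, smul_comm]

theorem generatesAt_choose {U : ℝ → E →L[ℂ] E} (f : generatorDomain U) :
    GeneratesAt U (f : E) (Classical.choose f.2) := Classical.choose_spec f.2

/-- The infinitesimal generator `L f = lim_{t ↓ 0} (U^t f - f) / t` of `U`. -/
def generator (U : ℝ → E →L[ℂ] E) : E →ₗ.[ℂ] E where
  domain := generatorDomain U
  toFun :=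
    { toFun := fun f => Classical.choose f.2
      map_add' := fun f g => by
        refine tendsto_nhds_unique (generatesAt_choose (f + g))
          ((Tendsto.add (generatesAt_choose f) (generatesAt_choose g)).congr fun t => ?_)
        rw [← smul_add, Submodule.coe_add, map_add]
        congr 1
        abel
      map_smul' := fun c f => by
        refine tendsto_nhds_unique (generatesAt_choose (c • f))
          ((Tendsto.const_smul (generatesAt_choose f) c).congr fun t => ?_)
        rw [Submodule.coe_smul, map_smul, ← smul_sub, smul_comm] }

/-- `R` is the resolvent `(s I - A)⁻¹`: a bounded operator that is a two-sided inverse of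
`s I - A : D(A) → E`. -/
def IsResolvent (A : E →ₗ.[ℂ] E) (s : ℂ) (R : E →L[ℂ] E) : Prop :=
  (∀ f : E, ∃ hf : R f ∈ A.domain, s • R f - A ⟨R f, hf⟩ = f) ∧
  (∀ u : A.domain, R (s • (u : E) - A u) = u)

/-- The resolvent set of `A`. -/
def opResolventSet (A : E →ₗ.[ℂ] E) : Set ℂ := {s | ∃ R : E →L[ℂ] E, IsResolvent A s R}

/-- The Laplace integral `∫_0^∞ e^{-s t} U^t f dt` converges (as an improper integral) to `l`. -/
def LaplaceConvergesTo (U : ℝ → E →L[ℂ] E) (s : ℂ) (f l : E) : Prop :=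
  Tendsto (fun T : ℝ => ∫ t in (0 : ℝ)..T, Complex.exp (-s * t) • U t f) atTop (𝓝 l)

/-- The region of convergence of the Laplace integral `∫_0^∞ e^{-s t} U^t dt`: the set of all `s`
for which it converges strongly. -/
def laplaceROC (U : ℝ → E →L[ℂ] E) : Set ℂ := {s | ∀ f : E, ∃ l : E, LaplaceConvergesTo U s f l}

end Semigroup

/-- The map `h = (φ₁, …, φₙ)` on the basin of attraction. -/
def conjugacy {n : ℕ} (S : ℝ → (Fin n → ℝ) → (Fin n → ℝ)) (xs : Fin n → ℝ)
    (φ : Fin n → (Fin n → ℝ) → ℂ) : basin S xs → Fin n → ℂ :=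
  fun x j => φ j x

/-- `U` is the Koopman semigroup on `S_h`: `U^t f = f ∘ S^t` on the basin for all `t ≥ 0`, and it is
strongly continuous. -/
structure IsKoopmanSemigroup {n : ℕ} {F : (Fin n → ℝ) → (Fin n → ℝ)}
    {S : ℝ → (Fin n → ℝ) → (Fin n → ℝ)} (hS : IsFlow F S) (xs : Fin n → ℝ)
    {h : basin S xs → Fin n → ℂ} (hh : Function.Injective (compMap h))
    (U : ℝ → ModulatedSB hh →L[ℂ] ModulatedSB hh) : Prop where
  comp : ∀ (t : ℝ) (ht : 0 ≤ t) (f : ModulatedSB hh) (x : basin S xs),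
    U t f x = f (flowOnBasin hS xs t ht x)
  continuous : ∀ f : ModulatedSB hh, ContinuousOn (fun t => U t f) (Ici 0)

end KoopmanResolvent

end

open KoopmanResolvent

noncomputable section

namespace KoopmanResolvent

/-! ### Entire functions of several complex variables -/

/-! In the coordinates supplied by `h` the dynamics is diagonal: `h ∘ S^t` is `h` with its `j`-th
entry multiplied by `e^{λ_j t}`. Composing `g ∘ h` with `S^t` therefore multiplies the `k`-th Taylor
term of `g` by `e^{μ_k t}`, where `μ_k = k·λ` has real part at most `0`. Normalized monomials form a
Hilbert basis (`FockSpace.basis`), transported to `S_h` by the isometry `g ↦ g ∘ h`, so the Koopman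
operators are diagonal contractions (`isKoopmanSemigroup`).

The operator-theoretic claims then hold for every `IsDiagonalSemigroup`. The generator multiplies
the coordinates by `μ_k` and the resolvent by `(s - μ_k)⁻¹`, which is bounded by `1 / Re s`. The
Laplace integral up to `T` has the coordinates of the resolvent times `1 - e^{-(s-μ_k)T}`, and
dominated convergence in `ℓ²` gives the limit. Convergence stops at `Re s = 0` because the constant
function `1` has `μ_0 = 0`.

The delicate point is that `g ∘ h` determines `g` (`injective_compMap_conjugacy`), although the
basin has only real dimension `n`. By `tendsto_rescaled_flow`, the leading homogeneous part of `φ_j`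
at the equilibrium is an eigenfunction of the linearized flow. In eigencoordinates `w` of the
Jacobian it contains only monomials `w^k` with `k·λ = λ_j`. Non-resonance, distinctness and `Re λ_j
< 0` leave `w_j` alone, so `φ_j = a_j w_j + O(‖y‖²)` with `a_j ≠ 0`. If `g ∘ h = 0` with `g ≠ 0`,
the leading homogeneous part of `g` vanishes on the image of `ℝⁿ` under an invertible complex linear
map, hence everywhere by `eq_zero_of_forall_real_pi`: a contradiction. -/

theorem hasSum_prod_pi {𝕜 : Type*} [RCLike 𝕜] : ∀ {n : ℕ} {f : Fin n → ℕ → 𝕜},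
    (∀ i, Summable fun m => ‖f i m‖) →
      (Summable fun k : Fin n → ℕ => ‖∏ i, f i (k i)‖) ∧
      HasSum (fun k : Fin n → ℕ => ∏ i, f i (k i)) (∏ i, ∑' m, f i m) := by
  intro n
  induction n with
  | zero =>
    intro f _
    refine ⟨(hasSum_fintype _).summable, ?_⟩
    simp
  | succ n ih =>
    intro f hf
    obtain ⟨h1, h2⟩ := ih (f := fun i => f i.succ) (fun i => hf i.succ)
    have hs : Summable fun x : ℕ × (Fin n → ℕ) => ‖f 0 x.1 * ∏ i, f (Fin.succ i) (x.2 i)‖ := by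
      simpa only [norm_mul] using (hf 0).mul_of_nonneg h1 (fun _ => norm_nonneg _)
        (fun _ => norm_nonneg _)
    constructor
    · rw [← (Fin.consEquiv (fun _ : Fin (n + 1) => ℕ)).summable_iff]
      refine hs.congr fun x => ?_
      simp [Fin.consEquiv, Fin.prod_univ_succ]
    · rw [← (Fin.consEquiv (fun _ : Fin (n + 1) => ℕ)).hasSum_iff, Fin.prod_univ_succ]
      refine ((hf 0).of_norm.hasSum.mul h2 hs.of_norm).congr_fun ?_
      intro x
      simp [Fin.consEquiv, Fin.prod_univ_succ]

theorem summable_pow_sum {n : ℕ} {q : ℝ} (h0 : 0 ≤ q) (h1 : q < 1) :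
    Summable fun k : Fin n → ℕ => q ^ (∑ i, k i) := by
  have := (hasSum_prod_pi (n := n) (f := fun _ m => q ^ m)
    (fun _ => by simpa [abs_of_nonneg h0] using summable_geometric_of_lt_one h0 h1)).1
  refine this.congr fun k => ?_
  rw [Finset.prod_pow_eq_pow_sum, Real.norm_of_nonneg (by positivity)]

theorem continuous_torusMap {n : ℕ} (c : Fin n → ℂ) (R : Fin n → ℝ) :
    Continuous (torusMap c R) := by
  unfold torusMap; fun_prop

theorem norm_torusMap_zero {n : ℕ} {R : ℝ} (hR : 0 < R) (θ : Fin n → ℝ) (i : Fin n) :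
    ‖torusMap 0 (fun _ => R) θ i‖ = R := by
  simp [torusMap, Complex.norm_exp_ofReal_mul_I, abs_of_pos hR]

theorem torusIntegrable_of_continuous {n : ℕ} {f : (Fin n → ℂ) → ℂ} {c : Fin n → ℂ}
    {R : Fin n → ℝ} (hf : Continuous fun θ => f (torusMap c R θ)) : TorusIntegrable f c R :=
  hf.continuousOn.integrableOn_compact isCompact_Icc

/-- The Cauchy integral formula on polydiscs. -/
theorem torusIntegral_cauchy {R : ℝ} (hR : 0 < R) : ∀ {n : ℕ} {g : (Fin n → ℂ) → ℂ},
    Differentiable ℂ g → ∀ {z : Fin n → ℂ}, (∀ i, ‖z i‖ < R) →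
      torusIntegral (fun x => (∏ i, (x i - z i))⁻¹ * g x) 0 (fun _ => R) =
        (2 * Real.pi * Complex.I) ^ n * g z := by
  intro n
  induction n with
  | zero =>
    intro g hg z hz
    rw [torusIntegral_dim0]
    simp [Subsingleton.elim z 0]
  | succ n ih =>
    intro g hg z hz
    have hne : ∀ (θ : Fin (n + 1) → ℝ) i, torusMap 0 (fun _ => R) θ i - z i ≠ 0 := fun θ i h => by
      have := norm_torusMap_zero hR θ i
      rw [sub_eq_zero.1 h] at this
      exact (hz i).ne this
    have hint : TorusIntegrable (fun x => (∏ i, (x i - z i))⁻¹ * g x) 0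
        (fun _ : Fin (n + 1) => R) := by
      apply torusIntegrable_of_continuous
      have hc := continuous_torusMap (0 : Fin (n + 1) → ℂ) (fun _ => R)
      refine Continuous.mul (Continuous.inv₀ (by fun_prop) fun θ => ?_) (hg.continuous.comp hc)
      exact Finset.prod_ne_zero_iff.2 fun i _ => hne θ i
    rw [torusIntegral_succ hint]
    have hcons : ∀ x : ℂ, Differentiable ℂ fun y : Fin n → ℂ => g (Fin.cons x y : Fin (n + 1) → ℂ) := by
      intro x
      refine hg.comp (differentiable_pi.2 fun i => ?_)
      refine Fin.cases ?_ (fun j => ?_) i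
      · simp
      · simp only [Fin.cons_succ]; fun_prop
    have hcons' : Differentiable ℂ fun x : ℂ =>
        g (Fin.cons x (fun i => z i.succ) : Fin (n + 1) → ℂ) := by
      refine hg.comp (differentiable_pi.2 fun i => ?_)
      refine Fin.cases ?_ (fun j => ?_) i
      · simp
      · simp
    have h1 : ∀ x : ℂ, torusIntegral (fun y : Fin n → ℂ =>
        (∏ i, ((Fin.cons x y : Fin (n + 1) → ℂ) i - z i))⁻¹ * g (Fin.cons x y : Fin (n + 1) → ℂ)) 0
          (fun _ => R) = (x - z 0)⁻¹ • ((2 * Real.pi * Complex.I) ^ n *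
            g (Fin.cons x (fun i => z i.succ) : Fin (n + 1) → ℂ)) := by
      intro x
      rw [← ih (hcons x) (z := fun i => z i.succ) (fun i => hz i.succ), smul_eq_mul,
        ← torusIntegral_const_mul]
      congr 1
      ext y
      simp [Fin.prod_univ_succ, mul_assoc, mul_left_comm]
    have h2 := DifferentiableOn.circleIntegral_sub_inv_smul (c := 0) (R := R) (w := z 0)
      (f := fun x => (2 * Real.pi * Complex.I) ^ n *
            g (Fin.cons x (fun i => z i.succ) : Fin (n + 1) → ℂ))
      ((hcons'.const_mul _).differentiableOn) (by simpa using hz 0)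
    have h3 : (Fin.cons (z 0) (fun i : Fin n => z i.succ) : Fin (n + 1) → ℂ) = z :=
      Fin.cons_self_tail z
    rw [h3] at h2
    simp only [Function.comp_def, Pi.zero_apply]
    change (∮ x in C(0, R), torusIntegral (fun y : Fin n → ℂ =>
        (∏ i, ((Fin.cons x y : Fin (n + 1) → ℂ) i - z i))⁻¹ * g (Fin.cons x y : Fin (n + 1) → ℂ)) 0
          (fun _ => R)) = _
    simp only [h1]
    rw [h2, smul_eq_mul]
    ring

/-- The Cauchy kernel is expanded in geometric series in each variable and integrated term by term
over the torus of radius `R`. The coefficients obtained may a priori depend on `R`; `exists_taylor`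
removes this dependence. -/
theorem exists_hasSum_of_differentiable {n : ℕ} {g : (Fin n → ℂ) → ℂ} (hg : Differentiable ℂ g)
    {R : ℝ} (hR : 0 < R) : ∃ c : (Fin n → ℕ) → ℂ,
      (∀ r : ℝ, 0 ≤ r → r < R → Summable fun k => ‖c k‖ * r ^ (∑ i, k i)) ∧
      ∀ z : Fin n → ℂ, (∀ i, ‖z i‖ < R) → HasSum (fun k => c k * ∏ i, z i ^ k i) (g z) := by
  set T : (Fin n → ℝ) → (Fin n → ℂ) := torusMap 0 (fun _ => R) with hT
  have hTc : Continuous T := continuous_torusMap _ _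
  have hTn : ∀ θ i, ‖T θ i‖ = R := norm_torusMap_zero hR
  have hT0 : ∀ θ i, T θ i ≠ 0 := fun θ i h => by
    have := hTn θ i; rw [h, norm_zero] at this; exact hR.ne this
  have hpi : (2 * Real.pi * Complex.I : ℂ) ^ n ≠ 0 := pow_ne_zero _ Complex.two_pi_I_ne_zero
  obtain ⟨M, hM⟩ : ∃ M, ∀ θ, ‖g (T θ)‖ ≤ M := by
    obtain ⟨M, hM⟩ := (isCompact_closedBall (0 : Fin n → ℂ) R).exists_bound_of_continuousOn
      hg.continuous.continuousOn
    refine ⟨M, fun θ => hM _ ?_⟩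
    rw [mem_closedBall_zero_iff, pi_norm_le_iff_of_nonneg hR.le]
    exact fun i => (hTn θ i).le
  -- The exponent `k i + 1` comes from `(x - z)⁻¹ = ∑ z^m / x^(m+1)`.
  set f : (Fin n → ℕ) → (Fin n → ℂ) → ℂ := fun k x => (∏ i, (x i)⁻¹ ^ (k i + 1)) * g x with hf
  have hfc : ∀ k, Continuous fun θ => f k (T θ) := fun k => by
    refine Continuous.mul (continuous_finsetProd _ fun i _ => ?_) (hg.continuous.comp hTc)
    exact (Continuous.inv₀ (by fun_prop) fun θ => hT0 θ i).pow _
  have hfn : ∀ k θ, ‖f k (T θ)‖ ≤ (R⁻¹ ^ (∑ i, k i)) * (R⁻¹ ^ n * M) := fun k θ => by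
    simp only [hf, norm_mul, norm_prod, norm_pow, norm_inv, hTn, pow_succ, Finset.prod_mul_distrib,
      Finset.prod_pow_eq_pow_sum, Finset.prod_const, Finset.card_univ, Fintype.card_fin, mul_assoc]
    gcongr
    exact hM θ
  set c : (Fin n → ℕ) → ℂ := fun k => ((2 * Real.pi * Complex.I : ℂ) ^ n)⁻¹ *
    torusIntegral (f k) 0 (fun _ => R) with hc
  -- Cauchy estimates for the coefficients, with a constant that does not depend on `k`.
  obtain ⟨K, hK⟩ : ∃ K, ∀ k, ‖c k‖ ≤ K * R⁻¹ ^ (∑ i, k i) := by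
    refine ⟨‖((2 * Real.pi * Complex.I : ℂ) ^ n)⁻¹‖ * (((2 * Real.pi) ^ n * ∏ _i : Fin n, |R|) *
      (R⁻¹ ^ n * M)), fun k => ?_⟩
    have := norm_torusIntegral_le_of_norm_le_const (hfn k)
    rw [hc, norm_mul]
    calc _ ≤ _ := mul_le_mul_of_nonneg_left this (norm_nonneg _)
      _ = _ := by ring
  refine ⟨c, fun r hr0 hrR => ?_, fun z hz => ?_⟩
  · refine Summable.of_nonneg_of_le (fun k => by positivity) (fun k => ?_)
      ((summable_pow_sum (n := n) (q := r / R) (by positivity) ((div_lt_one hR).2 hrR)).mul_left K)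
    calc ‖c k‖ * r ^ (∑ i, k i) ≤ (K * R⁻¹ ^ (∑ i, k i)) * r ^ (∑ i, k i) := by
          gcongr; exact hK k
      _ = K * (r / R) ^ (∑ i, k i) := by rw [mul_assoc, ← mul_pow, div_eq_inv_mul]
  · have hsum : ∀ θ, HasSum (fun k : Fin n → ℕ => (∏ i, z i ^ k i) * f k (T θ))
        ((∏ i, (T θ i - z i))⁻¹ * g (T θ)) := fun θ => by
      have hlt : ∀ i, ‖(T θ i)⁻¹ * z i‖ < 1 := fun i => by
        rw [norm_mul, norm_inv, hTn, inv_mul_lt_iff₀ hR, mul_one]; exact hz i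
      have h := (hasSum_prod_pi (f := fun i m => (T θ i)⁻¹ * ((T θ i)⁻¹ * z i) ^ m) (fun i => by
        simp only [norm_mul, norm_pow]
        simp only [norm_mul] at hlt
        exact (summable_geometric_of_lt_one (by positivity) (hlt i)).mul_left _)).2
      have h2 : ∏ i, ∑' m, (T θ i)⁻¹ * ((T θ i)⁻¹ * z i) ^ m = (∏ i, (T θ i - z i))⁻¹ := by
        rw [← Finset.prod_inv_distrib]
        refine Finset.prod_congr rfl fun i _ => ?_
        rw [tsum_mul_left, tsum_geometric_of_norm_lt_one (hlt i), ← mul_inv]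
        congr 1
        have := hT0 θ i
        field_simp
      rw [h2] at h
      refine (h.mul_right (g (T θ))).congr_fun fun k => ?_
      simp only [hf]
      rw [← mul_assoc, ← Finset.prod_mul_distrib]
      congr 1
      refine Finset.prod_congr rfl fun i _ => ?_
      rw [mul_pow]; ring
    have hI := hasSum_integral_of_summable_integral_norm
      (μ := volume.restrict (Icc (0 : Fin n → ℝ) fun _ => 2 * Real.pi))
      (F := fun (k : Fin n → ℕ) θ => (∏ i : Fin n, (R * Complex.exp (θ i * Complex.I) * Complex.I : ℂ)) •
        ((∏ i, z i ^ k i) * f k (T θ))) (fun k => ?_) ?_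
    · have h1 : ∀ θ : Fin n → ℝ, ∑' k : Fin n → ℕ,
          (∏ i : Fin n, (R * Complex.exp (θ i * Complex.I) * Complex.I : ℂ)) •
            ((∏ i, z i ^ k i) * f k (T θ)) =
          (∏ i : Fin n, (R * Complex.exp (θ i * Complex.I) * Complex.I : ℂ)) •
            ((∏ i, (T θ i - z i))⁻¹ * g (T θ)) := fun θ => ((hsum θ).const_smul _).tsum_eq
      simp only [h1] at hI
      have h3 := torusIntegral_cauchy hR hg hz
      simp only [torusIntegral] at h3
      rw [h3] at hI
      have h4 := hI.mul_left ((2 * Real.pi * Complex.I : ℂ) ^ n)⁻¹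
      rw [inv_mul_cancel_left₀ hpi] at h4
      refine h4.congr_fun fun k => ?_
      rw [hc]
      change _ = _ * torusIntegral (fun x => (∏ i, z i ^ k i) * f k x) 0 (fun _ => R)
      rw [torusIntegral_const_mul]
      ring
    · exact (torusIntegrable_of_continuous (R := fun _ => R) (c := 0)
        (f := fun x => (∏ i, z i ^ k i) * f k x)
        (continuous_const.mul (hfc k))).function_integrable
    · obtain ⟨r, hr0, hrR, hr⟩ : ∃ r, 0 ≤ r ∧ r < R ∧ ∀ i, ‖z i‖ ≤ r :=
        ⟨‖z‖, norm_nonneg _, (pi_norm_lt_iff hR).2 hz, norm_le_pi_norm z⟩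
      refine Summable.of_nonneg_of_le (fun k => integral_nonneg fun θ => norm_nonneg _) (fun k => ?_)
        ((summable_pow_sum (n := n) (q := r / R) (by positivity) ((div_lt_one hR).2 hrR)).mul_left
          ((R ^ n * (R⁻¹ ^ n * M)) * volume.real (Icc (0 : Fin n → ℝ) fun _ => 2 * Real.pi)))
      have hM0 : 0 ≤ M := (norm_nonneg _).trans (hM 0)
      have hb : ∀ θ : Fin n → ℝ,
          ‖(∏ i : Fin n, (R * Complex.exp (θ i * Complex.I) * Complex.I : ℂ)) •
            ((∏ i, z i ^ k i) * f k (T θ))‖ ≤ (R ^ n * (R⁻¹ ^ n * M)) * (r / R) ^ (∑ i, k i) := by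
        intro θ
        rw [norm_smul, norm_mul, norm_prod]
        have h1 : ∏ i : Fin n, ‖(R * Complex.exp (θ i * Complex.I) * Complex.I : ℂ)‖ = R ^ n := by
          simp [Complex.norm_exp_ofReal_mul_I, abs_of_pos hR]
        have h2 : ‖∏ i, z i ^ k i‖ ≤ r ^ (∑ i, k i) := by
          rw [norm_prod, ← Finset.prod_pow_eq_pow_sum]
          refine Finset.prod_le_prod (fun _ _ => norm_nonneg _) fun i _ => ?_
          rw [norm_pow]
          exact pow_le_pow_left₀ (norm_nonneg _) (hr i) _
        rw [h1]
        calc R ^ n * (‖∏ i, z i ^ k i‖ * ‖f k (T θ)‖)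
            ≤ R ^ n * (r ^ (∑ i, k i) * ((R⁻¹ ^ (∑ i, k i)) * (R⁻¹ ^ n * M))) := by
              gcongr; exact hfn k θ
          _ = _ := by rw [div_eq_mul_inv, mul_pow]; ring
      calc _ ≤ ∫ θ in (Icc (0 : Fin n → ℝ) fun _ => 2 * Real.pi),
              (R ^ n * (R⁻¹ ^ n * M)) * (r / R) ^ (∑ i, k i) := by
            refine integral_mono_of_nonneg (Eventually.of_forall fun _ => norm_nonneg _)
              (integrableOn_const (by exact measure_Icc_lt_top.ne)) (Eventually.of_forall hb)
        _ = _ := by simp [Measure.real]; ring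

/-! ### Limits of entire functions, and uniqueness from values on `ℝⁿ`. -/

/-- The one-variable Cauchy estimate applied on the complex line through `z` in direction `v`. The
circle has radius `r / (2‖v‖)` to stay inside the open ball, which costs the factor `2`. -/
theorem norm_fderiv_le_of_forall_mem_ball {E : Type*} [NormedAddCommGroup E] [NormedSpace ℂ E]
    {f : E → ℂ} (hf : Differentiable ℂ f) {z : E} {r M : ℝ} (hr : 0 < r)
    (hM : ∀ w ∈ Metric.ball z r, ‖f w‖ ≤ M) : ‖fderiv ℂ f z‖ ≤ 2 * M / r := by
  have hM0 : 0 ≤ M := (norm_nonneg _).trans (hM z (Metric.mem_ball_self hr))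
  refine ContinuousLinearMap.opNorm_le_bound _ (by positivity) fun v => ?_
  rcases eq_or_ne v 0 with rfl | hv
  · simp
  have hv' : 0 < ‖v‖ := norm_pos_iff.2 hv
  have hl : ∀ t : ℂ, HasDerivAt (fun t : ℂ => z + t • v) v t := fun t => by
    simpa using ((hasDerivAt_id t).smul_const v).const_add z
  have h1 : HasDerivAt (fun t : ℂ => f (z + t • v)) (fderiv ℂ f z v) 0 := by
    have h2 : HasFDerivAt f (fderiv ℂ f z) (z + (0 : ℂ) • v) := by simpa using (hf z).hasFDerivAt
    exact h2.comp_hasDerivAt (0 : ℂ) (hl 0)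
  have h2 : Differentiable ℂ (fun t : ℂ => f (z + t • v)) :=
    hf.comp fun t => (hl t).differentiableAt
  have h3 := Complex.norm_deriv_le_of_forall_mem_sphere_norm_le (c := 0) (R := r / (2 * ‖v‖))
    (C := M) (f := fun t : ℂ => f (z + t • v)) (by positivity) h2.diffContOnCl (fun t ht => by
      refine hM _ ?_
      rw [mem_sphere_zero_iff_norm] at ht
      rw [mem_ball_iff_norm, add_sub_cancel_left, norm_smul, ht]
      field_simp
      linarith)
  rw [h1.deriv] at h3
  refine h3.trans (le_of_eq ?_)
  field_simp

/-- A limit of entire functions that is locally uniform is entire. -/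
theorem differentiable_of_uniformCauchySeqOn {E : Type*} [NormedAddCommGroup E] [NormedSpace ℂ E]
    {F : ℕ → E → ℂ} {f : E → ℂ} (hF : ∀ N, Differentiable ℂ (F N))
    (hc : ∀ z, UniformCauchySeqOn F atTop (Metric.ball z 2))
    (hf : ∀ z, Tendsto (fun N => F N z) atTop (𝓝 (f z))) : Differentiable ℂ f := by
  intro z
  have h1 : UniformCauchySeqOn (fun N => fderiv ℂ (F N)) atTop (Metric.ball z 1) := by
    rw [Metric.uniformCauchySeqOn_iff]
    intro ε hε
    -- A unit ball around a point of `ball z 1` lies in `ball z 2`, and the Cauchy estimate doubles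
    -- the bound: `ε / 4` becomes `ε / 2 < ε`.
    obtain ⟨N, hN⟩ := Metric.uniformCauchySeqOn_iff.1 (hc z) (ε / 4) (by positivity)
    refine ⟨N, fun m hm k hk x hx => ?_⟩
    have h2 : fderiv ℂ (F m) x - fderiv ℂ (F k) x = fderiv ℂ (fun y => F m y - F k y) x :=
      (fderiv_fun_sub (hF m x) (hF k x)).symm
    rw [dist_eq_norm, h2]
    have h3 := norm_fderiv_le_of_forall_mem_ball ((hF m).sub (hF k)) (z := x) (r := 1)
      (M := ε / 4) one_pos (fun w hw => by
        have := hN m hm k hk w (by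
          rw [Metric.mem_ball] at *
          calc dist w z ≤ dist w x + dist x z := dist_triangle _ _ _
            _ < 2 := by linarith)
        rw [dist_eq_norm] at this
        exact this.le)
    calc _ ≤ _ := h3
      _ < ε := by linarith
  have h2 : ∀ x ∈ Metric.ball z 1, ∃ l, Tendsto (fun N => fderiv ℂ (F N) x) atTop (𝓝 l) :=
    fun x hx => cauchySeq_tendsto_of_complete (h1.cauchySeq hx)
  choose! g' hg' using h2
  exact (hasFDerivAt_of_tendstoUniformlyOn Metric.isOpen_ball (h1.tendstoUniformlyOn_of_tendsto hg')
    (fun N x _ => (hF N x).hasFDerivAt) (fun x _ => hf x)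
    (Metric.mem_ball_self one_pos)).differentiableAt

theorem eq_zero_of_forall_real {f : ℂ → ℂ} (hf : Differentiable ℂ f)
    (h : ∀ x : ℝ, f x = 0) (z : ℂ) : f z = 0 := by
  have ha : AnalyticOnNhd ℂ f univ := fun w _ => hf.analyticAt w
  refine ha.eqOn_zero_of_preconnected_of_frequently_eq_zero isPreconnected_univ (mem_univ (0 : ℂ))
    ?_ (mem_univ z)
  have h1 : Tendsto (fun x : ℝ => (x : ℂ)) (𝓝[≠] 0) (𝓝[≠] 0) := by
    refine tendsto_nhdsWithin_iff.2 ⟨?_, ?_⟩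
    · exact (Complex.continuous_ofReal.tendsto' 0 0 (by simp)).mono_left nhdsWithin_le_nhds
    · filter_upwards [self_mem_nhdsWithin] with x hx
      simpa using hx
  exact h1.frequently (Eventually.of_forall h).frequently

/-- An entire function that vanishes on `ℝⁿ` vanishes. -/
theorem eq_zero_of_forall_real_pi {n : ℕ} {g : (Fin n → ℂ) → ℂ} (hg : Differentiable ℂ g)
    (h : ∀ x : Fin n → ℝ, g (fun i => (x i : ℂ)) = 0) (z : Fin n → ℂ) : g z = 0 := by
  -- Induction on the set `s` of coordinates allowed to be non-real; each new coordinate is freed by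
  -- the one-variable identity theorem.
  have key : ∀ (s : Finset (Fin n)) (z : Fin n → ℂ), (∀ i ∉ s, (z i).im = 0) → g z = 0 := by
    intro s
    induction s using Finset.induction_on with
    | empty =>
      intro z hz
      rw [← h fun i => (z i).re]
      congr 1
      ext i
      exact Complex.ext (by simp) (by simpa using hz i (by simp))
    | insert a s ha ih =>
      intro z hz
      have h1 : Differentiable ℂ fun ζ : ℂ => g (Function.update z a ζ) :=
        hg.comp (differentiable_pi.2 fun i => by
          rcases eq_or_ne i a with rfl | hi
          · simp
          · simp [hi])
      have h2 := eq_zero_of_forall_real h1 (fun x => ih _ fun i hi => by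
        rcases eq_or_ne i a with rfl | hia
        · simp
        · simpa [hia] using hz i (by simp [hi, hia])) (z a)
      simpa using h2
  exact key Finset.univ z (by simp)

/-! ### Monomials in the Segal–Bargmann space -/

theorem fockMonomial_apply {n : ℕ} (k : Fin n → ℕ) (z : Fin n → ℂ) :
    fockMonomial k z = ∏ i, z i ^ k i := rfl

theorem continuous_fockMonomial {n : ℕ} (k : Fin n → ℕ) :
    Continuous fun z => fockMonomial k z := (fockMonomial k).differentiable.continuous

theorem FockSpace.inner_def {n : ℕ} (f g : FockSpace n) :
    inner ℂ f g = ∫ z, conj (f z) * g z * (weight n z : ℂ) := rfl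

theorem FockSpace.norm_sq_eq {n : ℕ} (f : FockSpace n) :
    ‖f‖ ^ 2 = ∫ z, ‖f z‖ ^ 2 * weight n z := by
  have h := inner_self_eq_norm_sq_to_K (𝕜 := ℂ) f
  rw [FockSpace.inner_def, FockSpace.integral_self] at h
  exact Complex.ofReal_injective (by rw [Complex.ofReal_pow]; exact h.symm)

theorem weight_le {n : ℕ} (z : Fin n → ℂ) : weight n z ≤ (Real.pi ^ n)⁻¹ := by
  unfold weight
  refine mul_le_of_le_one_right (by positivity) (Real.exp_le_one_iff.2 ?_)
  simpa using Finset.sum_nonneg fun i _ => sq_nonneg ‖z i‖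

/-! ### Orthogonality of monomials on polydiscs and uniqueness of Taylor coefficients. -/

/-- The norm on `Fin n → ℂ` is the sup norm, so the ball is a polydisc; it and Lebesgue measure are
invariant under independent rotations of the coordinates. -/
theorem setIntegral_closedBall_rotate {n : ℕ} {a : Fin n → ℂ} (ha : ∀ i, ‖a i‖ = 1) (r : ℝ)
    (G : (Fin n → ℂ) → ℂ) :
    ∫ z : Fin n → ℂ in Metric.closedBall 0 r, G (fun i => a i * z i) =
      ∫ z in Metric.closedBall 0 r, G z := by
  have h1 : MeasurePreserving (fun (z : Fin n → ℂ) i => a i * z i) volume volume :=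
    volume_preserving_pi (f := fun i w => a i * w) fun i =>
      LinearIsometryEquiv.measurePreserving (rotation ⟨a i, mem_sphere_zero_iff_norm.2 (ha i)⟩)
  have h2 : MeasurableEmbedding fun (z : Fin n → ℂ) i => a i * z i := by
    refine Continuous.measurableEmbedding (by fun_prop) fun z w h => funext fun i => ?_
    have h0 : a i ≠ 0 := fun h => by simpa [h] using ha i
    exact mul_left_cancel₀ h0 (congrFun h i)
  rw [← h1.setIntegral_preimage_emb h2 G]
  congr 2
  ext z
  have h3 : ∀ i, ‖a i‖₊ = 1 := fun i => NNReal.eq (ha i)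
  simp only [mem_preimage, mem_closedBall_zero_iff, Pi.norm_def, nnnorm_mul, h3, one_mul]

theorem integral_closedBall_monomial_of_ne {n : ℕ} {k l : Fin n → ℕ} (h : k ≠ l) (r : ℝ) :
    ∫ z in Metric.closedBall 0 r, conj (fockMonomial k z) * fockMonomial l z * (weight n z : ℂ)
      = 0 := by
  obtain ⟨i, hi⟩ := Function.ne_iff.1 h
  have hd : ((l i : ℝ) - k i) ≠ 0 := by
    rw [sub_ne_zero]; exact_mod_cast hi.symm
  -- Rotating only the coordinate `i`, where the exponents differ, by this angle multiplies the
  -- integrand by `e^{iπ} = -1`, so the integral equals its own negative.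
  set θ : ℝ := Real.pi / ((l i : ℝ) - k i) with hθ
  set a : Fin n → ℂ := fun j => if j = i then Complex.exp (θ * Complex.I) else 1 with ha
  have ha1 : ∀ j, ‖a j‖ = 1 := fun j => by
    simp only [ha]
    split_ifs
    · exact Complex.norm_exp_ofReal_mul_I θ
    · simp
  have h1 := setIntegral_closedBall_rotate ha1 r
    fun z => conj (fockMonomial k z) * fockMonomial l z * (weight n z : ℂ)
  have h2 : ∀ z : Fin n → ℂ, conj (fockMonomial k fun i => a i * z i) *
      fockMonomial l (fun i => a i * z i) * (weight n (fun i => a i * z i) : ℂ) =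
      -(conj (fockMonomial k z) * fockMonomial l z * (weight n z : ℂ)) := by
    intro z
    have hw : weight n (fun i => a i * z i) = weight n z := by simp [weight, ha1]
    have hm : ∀ m : Fin n → ℕ, fockMonomial m (fun i => a i * z i) =
        Complex.exp (θ * Complex.I) ^ m i * fockMonomial m z := fun m => by
      simp only [fockMonomial_apply, mul_pow, Finset.prod_mul_distrib]
      congr 1
      rw [Finset.prod_eq_single i]
      · simp [ha]
      · intro j _ hj; simp [ha, hj]
      · simp
    rw [hw, hm, hm, map_mul]
    have he : conj (Complex.exp (θ * Complex.I) ^ k i) * Complex.exp (θ * Complex.I) ^ l i = -1 := by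
      rw [map_pow, ← Complex.exp_conj, ← Complex.exp_nat_mul, ← Complex.exp_nat_mul,
        ← Complex.exp_add, ← Complex.exp_pi_mul_I]
      congr 1
      have : (l i : ℂ) - k i ≠ 0 := by exact_mod_cast hd
      simp only [map_mul, Complex.conj_ofReal, Complex.conj_I, hθ]
      push_cast
      field_simp
      ring
    linear_combination (conj (fockMonomial k z) * fockMonomial l z * (weight n z : ℂ)) * he
  simp only [h2] at h1
  rw [integral_neg] at h1
  linear_combination (-1 / 2 : ℂ) * h1

theorem integral_closedBall_monomial_self_ne_zero {n : ℕ} (k : Fin n → ℕ) {r : ℝ} (hr : 0 < r) :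
    ∫ z in Metric.closedBall 0 r, conj (fockMonomial k z) * fockMonomial k z * (weight n z : ℂ)
      ≠ 0 := by
  have h1 : ∀ z : Fin n → ℂ, conj (fockMonomial k z) * fockMonomial k z * (weight n z : ℂ) =
      ((‖fockMonomial k z‖ ^ 2 * weight n z : ℝ) : ℂ) := fun z => by
    rw [Complex.conj_mul']; push_cast; rfl
  simp only [h1]
  rw [integral_complex_ofReal, Complex.ofReal_ne_zero]
  refine ((setIntegral_pos_iff_support_of_nonneg_ae (Eventually.of_forall fun z =>
    mul_nonneg (sq_nonneg _) (weight_pos n z).le) (fockMonomial k).integrable_sq.integrableOn).2 ?_).ne'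
  have ho : IsOpen (Set.pi univ fun _ : Fin n => Metric.ball (0 : ℂ) r \ {0}) :=
    isOpen_set_pi finite_univ fun _ _ => Metric.isOpen_ball.sdiff isClosed_singleton
  have hne : (Set.pi univ fun _ : Fin n => Metric.ball (0 : ℂ) r \ {0}).Nonempty := by
    refine ⟨fun _ => ((r / 2 : ℝ) : ℂ), fun i _ => ⟨?_, ?_⟩⟩
    · rw [mem_ball_zero_iff, Complex.norm_real, Real.norm_of_nonneg (by positivity)]; linarith
    · simp [hr.ne']
  refine (ho.measure_pos volume hne).trans_le (measure_mono fun z hz => ⟨?_, ?_⟩)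
  · rw [Function.mem_support]
    refine mul_ne_zero (pow_ne_zero _ (norm_ne_zero_iff.2 ?_)) (weight_pos n z).ne'
    rw [fockMonomial_apply]
    exact Finset.prod_ne_zero_iff.2 fun i _ => pow_ne_zero _ (hz i (mem_univ i)).2
  · rw [mem_closedBall_zero_iff, pi_norm_le_iff_of_nonneg hr.le]
    exact fun i => (mem_ball_zero_iff.1 (hz i (mem_univ i)).1).le

theorem norm_fockMonomial_le {n : ℕ} (k : Fin n → ℕ) {z : Fin n → ℂ} {r : ℝ}
    (hz : ‖z‖ ≤ r) : ‖fockMonomial k z‖ ≤ r ^ (∑ i, k i) := by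
  rw [fockMonomial_apply, norm_prod, ← Finset.prod_pow_eq_pow_sum]
  refine Finset.prod_le_prod (fun _ _ => norm_nonneg _) fun i _ => ?_
  rw [norm_pow]
  exact pow_le_pow_left₀ (norm_nonneg _) ((norm_le_pi_norm z i).trans hz) _

/-- On a bounded polydisc the power series converges uniformly enough to be integrated termwise, and
orthogonality keeps only the `k`-th term. Working at finite radius avoids an interchange over all of
`ℂⁿ`. -/
theorem integral_closedBall_conj_monomial_mul {n : ℕ} {c : (Fin n → ℕ) → ℂ}
    {g : (Fin n → ℂ) → ℂ} {r : ℝ} (hr : 0 ≤ r)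
    (hs : Summable fun k => ‖c k‖ * r ^ (∑ i, k i))
    (hg : ∀ z, ‖z‖ ≤ r → HasSum (fun k => c k * ∏ i, z i ^ k i) (g z)) (k : Fin n → ℕ) :
    ∫ z in Metric.closedBall 0 r, conj (fockMonomial k z) * g z * (weight n z : ℂ) =
      c k * ∫ z in Metric.closedBall 0 r,
        conj (fockMonomial k z) * fockMonomial k z * (weight n z : ℂ) := by
  have hw := continuous_weight n
  have hw' : Continuous fun z => (weight n z : ℂ) := Complex.continuous_ofReal.comp hw
  have hmc := fun l : Fin n → ℕ => continuous_fockMonomial l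
  have hcc : ∀ l : Fin n → ℕ, Continuous fun z : Fin n → ℂ =>
      conj (fockMonomial k z) * fockMonomial l z * (weight n z : ℂ) := fun l =>
    (((Complex.continuous_conj.comp (hmc k)).mul (hmc l)).mul hw')
  have hint : ∀ l : Fin n → ℕ, Integrable (fun z : Fin n → ℂ =>
      c l * (conj (fockMonomial k z) * fockMonomial l z * (weight n z : ℂ)))
      (volume.restrict (Metric.closedBall 0 r)) := fun l =>
    (continuous_const.mul (hcc l)).continuousOn.integrableOn_compact (isCompact_closedBall _ _)
  have h := hasSum_integral_of_summable_integral_norm hint ?_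
  · have h1 : ∀ l : Fin n → ℕ, ∫ z in Metric.closedBall 0 r,
        c l * (conj (fockMonomial k z) * fockMonomial l z * (weight n z : ℂ)) =
        c l * ∫ z in Metric.closedBall 0 r,
          conj (fockMonomial k z) * fockMonomial l z * (weight n z : ℂ) := fun l =>
      integral_const_mul _ _
    simp only [h1] at h
    have h2 := hasSum_single (f := fun l : Fin n → ℕ => c l * ∫ z in Metric.closedBall 0 r,
          conj (fockMonomial k z) * fockMonomial l z * (weight n z : ℂ)) k (fun l hl => by
        rw [integral_closedBall_monomial_of_ne hl.symm, mul_zero])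
    rw [h2.unique h]
    refine setIntegral_congr_fun Metric.isClosed_closedBall.measurableSet fun z hz => ?_
    have h3 := ((hg z (mem_closedBall_zero_iff.1 hz)).mul_left (conj (fockMonomial k z))).mul_right
      (weight n z : ℂ)
    rw [← h3.tsum_eq]
    refine tsum_congr fun l => ?_
    rw [fockMonomial_apply l]; ring
  · refine Summable.of_nonneg_of_le (fun l => integral_nonneg fun _ => norm_nonneg _) (fun l => ?_)
      (hs.mul_left (r ^ (∑ i, k i) * (Real.pi ^ n)⁻¹ * volume.real (Metric.closedBall (0 : Fin n → ℂ) r)))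
    calc _ ≤ ∫ z in Metric.closedBall (0 : Fin n → ℂ) r,
            r ^ (∑ i, k i) * (Real.pi ^ n)⁻¹ * (‖c l‖ * r ^ (∑ i, l i)) := by
          refine setIntegral_mono_on (hint l).norm
            (integrableOn_const (isCompact_closedBall _ _).measure_ne_top)
            Metric.isClosed_closedBall.measurableSet fun z hz => ?_
          have hz' := mem_closedBall_zero_iff.1 hz
          rw [norm_mul, norm_mul, norm_mul, RCLike.norm_conj, Complex.norm_real,
            Real.norm_of_nonneg (weight_pos n z).le]
          calc _ ≤ ‖c l‖ * (r ^ (∑ i, k i) * r ^ (∑ i, l i) * (Real.pi ^ n)⁻¹) := by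
                gcongr
                · exact (weight_pos n z).le
                · exact norm_fockMonomial_le k hz'
                · exact norm_fockMonomial_le l hz'
                · exact weight_le z
            _ = _ := by ring
      _ = _ := by rw [setIntegral_const, smul_eq_mul]; ring

/-- Testing the series against the `k`-th monomial on the polydisc isolates `c k` times a nonzero
integral. This uniqueness is what allows coefficients to be compared throughout. -/
theorem eq_zero_of_hasSum_zero {n : ℕ} {c : (Fin n → ℕ) → ℂ} {r : ℝ} (hr : 0 < r)
    (hs : Summable fun k => ‖c k‖ * r ^ (∑ i, k i))
    (hg : ∀ z : Fin n → ℂ, ‖z‖ ≤ r → HasSum (fun k => c k * ∏ i, z i ^ k i) 0) : c = 0 := by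
  ext k
  have h := integral_closedBall_conj_monomial_mul hr.le hs hg k
  simp only [mul_zero, zero_mul, integral_zero] at h
  exact (mul_eq_zero.1 h.symm).resolve_right (integral_closedBall_monomial_self_ne_zero k hr)

/-- Every entire function is the sum of its Taylor series. -/
theorem exists_taylor {n : ℕ} {g : (Fin n → ℂ) → ℂ} (hg : Differentiable ℂ g) :
    ∃ c : (Fin n → ℕ) → ℂ, (∀ r : ℝ, 0 ≤ r → Summable fun k => ‖c k‖ * r ^ (∑ i, k i)) ∧
      ∀ z, HasSum (fun k => c k * ∏ i, z i ^ k i) (g z) := by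
  obtain ⟨c, hc1, hc2⟩ := exists_hasSum_of_differentiable hg (zero_lt_two)
  -- The coefficients found at radius `R` agree with those found at radius `2`, since both represent
  -- `g` on the closed unit polydisc.
  have key : ∀ R : ℝ, 1 < R → (∀ r : ℝ, 0 ≤ r → r < R → Summable fun k => ‖c k‖ * r ^ (∑ i, k i)) ∧
      ∀ z : Fin n → ℂ, (∀ i, ‖z i‖ < R) → HasSum (fun k => c k * ∏ i, z i ^ k i) (g z) := by
    intro R hR
    obtain ⟨d, hd1, hd2⟩ := exists_hasSum_of_differentiable hg (zero_lt_one.trans hR)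
    have : c = d := by
      rw [← sub_eq_zero]
      refine eq_zero_of_hasSum_zero one_pos ?_ fun z hz => ?_
      · refine Summable.of_nonneg_of_le (fun k => by positivity) (fun k => ?_)
          ((hc1 1 zero_le_one one_lt_two).add (hd1 1 zero_le_one hR))
        rw [← add_mul]
        gcongr
        exact norm_sub_le _ _
      · have h1 := (hc2 z fun i => ((norm_le_pi_norm z i).trans hz).trans_lt one_lt_two).sub
          (hd2 z fun i => ((norm_le_pi_norm z i).trans hz).trans_lt hR)
        simpa [sub_mul] using h1
    rw [this]
    exact ⟨hd1, hd2⟩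
  refine ⟨c, fun r hr => (key (r + 2) (by linarith)).1 r hr (by linarith), fun z => ?_⟩
  refine (key (‖z‖ + 2) (by linarith [norm_nonneg z])).2 z fun i => ?_
  linarith [norm_le_pi_norm z i]

namespace FockSpace

theorem tendsto_integral_closedBall {n : ℕ} (f g : FockSpace n) :
    Tendsto (fun N : ℕ => ∫ z in Metric.closedBall 0 (N : ℝ), conj (f z) * g z * (weight n z : ℂ))
      atTop (𝓝 (inner ℂ f g)) := by
  have h := tendsto_setIntegral_of_monotone (μ := volume)
    (s := fun N : ℕ => Metric.closedBall (0 : Fin n → ℂ) (N : ℝ))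
    (f := fun z => conj (f z) * g z * (weight n z : ℂ))
    (fun N => Metric.isClosed_closedBall.measurableSet)
    (fun N M h => Metric.closedBall_subset_closedBall (by exact_mod_cast h))
    (integrable_inner f g).integrableOn
  rwa [Metric.iUnion_closedBall_nat, setIntegral_univ] at h

theorem inner_monomial_of_ne {n : ℕ} {k l : Fin n → ℕ} (h : k ≠ l) :
    inner ℂ (fockMonomial k) (fockMonomial l) = 0 :=
  tendsto_nhds_unique (tendsto_integral_closedBall _ _)
    (by simp only [integral_closedBall_monomial_of_ne h]; exact tendsto_const_nhds)

/-- Letting the radius tend to infinity in the polydisc identity gives `⟪z^k, g⟫ = c k * ‖z^k‖²`, so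
the Taylor series of `g` is its orthogonal expansion, read pointwise. -/
theorem hasSum_inner_monomial {n : ℕ} (g : FockSpace n) (z : Fin n → ℂ) :
    HasSum (fun k => inner ℂ (fockMonomial k) g / (‖fockMonomial k‖ : ℂ) ^ 2 * ∏ i, z i ^ k i)
      (g z) := by
  obtain ⟨c, hc1, hc2⟩ := exists_taylor g.differentiable
  refine (hc2 z).congr_fun fun k => ?_
  have h1 := tendsto_integral_closedBall (fockMonomial k) g
  simp only [fun N : ℕ => integral_closedBall_conj_monomial_mul (Nat.cast_nonneg N)
    (hc1 N (Nat.cast_nonneg N)) (fun z _ => hc2 z) k] at h1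
  have h2 := tendsto_nhds_unique h1
    ((tendsto_integral_closedBall (fockMonomial k) (fockMonomial k)).const_mul (c k))
  have h3 : fockMonomial k ≠ 0 := fun h => by
    have h4 : fockMonomial k (fun _ => 1) = 0 := by rw [h]; simp
    simp [fockMonomial_apply] at h4
  rw [h2, inner_self_eq_norm_sq_to_K]
  have h5 : (‖fockMonomial k‖ : ℂ) ≠ 0 := by exact_mod_cast norm_ne_zero_iff.2 h3
  simp [h5]

/-- The integral factors over the coordinates, and each factor is `Γ(k i + 1)`. -/
theorem norm_fockMonomial_sq {n : ℕ} (k : Fin n → ℕ) :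
    ‖fockMonomial k‖ ^ 2 = ∏ i, ((k i).factorial : ℝ) := by
  rw [norm_sq_eq]
  have h1 : ∀ z : Fin n → ℂ, ‖fockMonomial k z‖ ^ 2 * weight n z =
      ∏ i, (Real.pi⁻¹ * (‖z i‖ ^ (2 * k i) * Real.exp (-‖z i‖ ^ 2))) := fun z => by
    simp only [fockMonomial_apply, weight, norm_prod, norm_pow, Finset.prod_mul_distrib,
      ← Finset.prod_pow, ← Finset.sum_neg_distrib, Real.exp_sum, ← pow_mul, mul_comm 2,
      Finset.prod_const, Finset.card_univ, Fintype.card_fin, inv_pow]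
    ring
  simp only [h1]
  rw [integral_fintype_prod_volume_eq_prod
    (fun i (w : ℂ) => Real.pi⁻¹ * (‖w‖ ^ (2 * k i) * Real.exp (-‖w‖ ^ 2)))]
  refine Finset.prod_congr rfl fun i _ => ?_
  rw [integral_const_mul]
  have h := Complex.integral_rpow_mul_exp_neg_rpow (p := 2) (q := ((2 * k i : ℕ) : ℝ)) (by norm_num)
    (by have : (0 : ℝ) ≤ ((2 * k i : ℕ) : ℝ) := by positivity
        linarith)
  simp only [Real.rpow_natCast, Real.rpow_two] at h
  have h2 : (((2 * k i : ℕ) : ℝ) + 2) / 2 = (k i : ℝ) + 1 := by push_cast; ring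
  rw [h, h2, Real.Gamma_nat_eq_factorial]
  field_simp

end FockSpace

/-! ### Point evaluations, completeness and the Hilbert basis of monomials. -/

namespace FockSpace

theorem norm_fockMonomial_pos {n : ℕ} (k : Fin n → ℕ) : 0 < ‖fockMonomial k‖ := by
  have h : 0 < ‖fockMonomial k‖ ^ 2 := by
    rw [norm_fockMonomial_sq]
    exact Finset.prod_pos fun i _ => by exact_mod_cast Nat.factorial_pos _
  exact (norm_nonneg _).lt_of_ne fun h0 => by simp [← h0] at h

/-- The normalized monomials. -/
def unitMonomial {n : ℕ} (k : Fin n → ℕ) : FockSpace n :=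
  ((‖fockMonomial k‖⁻¹ : ℝ) : ℂ) • fockMonomial k

theorem orthonormal_unitMonomial (n : ℕ) : Orthonormal ℂ (unitMonomial (n := n)) := by
  refine ⟨fun k => ?_, fun k l h => ?_⟩
  · rw [unitMonomial, norm_smul, Complex.norm_real, norm_inv, norm_norm,
      inv_mul_cancel₀ (norm_fockMonomial_pos k).ne']
  · simp only [unitMonomial, inner_smul_left, inner_smul_right, inner_monomial_of_ne h, mul_zero]

theorem hasSum_unitMonomial {n : ℕ} (f : FockSpace n) (z : Fin n → ℂ) :
    HasSum (fun k => inner ℂ (unitMonomial k) f * unitMonomial k z) (f z) := by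
  refine (hasSum_inner_monomial f z).congr_fun fun k => ?_
  have h : (‖fockMonomial k‖ : ℂ) ≠ 0 := by exact_mod_cast (norm_fockMonomial_pos k).ne'
  rw [unitMonomial, inner_smul_left, map_smul, Pi.smul_apply, fockMonomial_apply]
  simp only [Complex.conj_ofReal, smul_eq_mul]
  push_cast
  field_simp

/-- Evaluation is bounded, locally uniformly in the point. -/
theorem exists_norm_apply_le (n : ℕ) (r : ℝ) :
    ∃ K : ℝ, ∀ (f : FockSpace n) (z : Fin n → ℂ), ‖z‖ ≤ r → ‖f z‖ ≤ K * ‖f‖ := by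
  have hs : Summable fun k : Fin n → ℕ => ∏ i, ((r ^ 2) ^ k i / (k i).factorial) := by
    refine (hasSum_prod_pi (𝕜 := ℝ) (f := fun _ m => (r ^ 2) ^ m / (m.factorial : ℝ))
      fun _ => ?_).2.summable
    exact (Real.summable_pow_div_factorial (r ^ 2)).norm
  have hnn : ∀ k : Fin n → ℕ, 0 ≤ ∏ i, ((r ^ 2) ^ k i / ((k i).factorial : ℝ)) := fun k =>
    Finset.prod_nonneg fun i _ => by positivity
  -- The constant is a bound for `(∑ |e_k(z)|²)^{1/2}` over the normalized monomials `e_k`;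
  -- Cauchy–Schwarz and Bessel's inequality on finite partial sums give the estimate.
  refine ⟨Real.sqrt (∑' k : Fin n → ℕ, ∏ i, ((r ^ 2) ^ k i / (k i).factorial)), fun f z hz => ?_⟩
  have hr : 0 ≤ r := (norm_nonneg z).trans hz
  refine le_of_tendsto (hasSum_unitMonomial f z).norm (Eventually.of_forall fun s => ?_)
  refine abs_le_of_sq_le_sq' ?_ (by positivity) |>.2
  have h1 : ∀ k, ‖unitMonomial k z‖ ^ 2 ≤ ∏ i, ((r ^ 2) ^ k i / ((k i).factorial : ℝ)) := fun k => by
    rw [unitMonomial, map_smul, Pi.smul_apply, norm_smul, mul_pow, Complex.norm_real, norm_inv,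
      norm_norm, inv_pow, norm_fockMonomial_sq, Finset.prod_div_distrib, ← div_eq_inv_mul]
    refine div_le_div_of_nonneg_right ?_ (Finset.prod_nonneg fun i _ => by positivity)
    rw [Finset.prod_pow_eq_pow_sum, ← pow_mul, mul_comm 2, pow_mul]
    exact pow_le_pow_left₀ (norm_nonneg _) (norm_fockMonomial_le k hz) 2
  calc ‖∑ k ∈ s, inner ℂ (unitMonomial k) f * unitMonomial k z‖ ^ 2
      ≤ (∑ k ∈ s, ‖inner ℂ (unitMonomial k) f‖ * ‖unitMonomial k z‖) ^ 2 := by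
        refine pow_le_pow_left₀ (norm_nonneg _) ((norm_sum_le _ _).trans_eq ?_) 2
        simp only [norm_mul]
    _ ≤ (∑ k ∈ s, ‖inner ℂ (unitMonomial k) f‖ ^ 2) * ∑ k ∈ s, ‖unitMonomial k z‖ ^ 2 :=
        Finset.sum_mul_sq_le_sq_mul_sq _ _ _
    _ ≤ ‖f‖ ^ 2 * ∑' k : Fin n → ℕ, ∏ i, ((r ^ 2) ^ k i / (k i).factorial) := by
        gcongr
        · exact (orthonormal_unitMonomial n).sum_inner_products_le f
        · exact (Finset.sum_le_sum fun k _ => h1 k).trans (hs.sum_le_tsum s fun k _ => hnn k)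
    _ = _ := by rw [mul_pow, Real.sq_sqrt (tsum_nonneg hnn), mul_comm]

/-- Fatou's lemma for Bochner integrals of nonnegative functions. -/
theorem integrable_of_tendsto_of_integral_le {α : Type*} [MeasurableSpace α] {μ : Measure α}
    {F : ℕ → α → ℝ} {f : α → ℝ} {C : ℝ} (hF : ∀ N, Integrable (F N) μ)
    (hm : ∀ N, Measurable (F N)) (h0 : ∀ N x, 0 ≤ F N x)
    (hC : ∀ᶠ N in atTop, ∫ x, F N x ∂μ ≤ C) (hf : ∀ x, Tendsto (fun N => F N x) atTop (𝓝 (f x))) :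
    Integrable f μ ∧ ∫ x, f x ∂μ ≤ C := by
  have hfm : Measurable f := measurable_of_tendsto_metrizable hm (tendsto_pi_nhds.2 hf)
  have hf0 : ∀ x, 0 ≤ f x := fun x => ge_of_tendsto' (hf x) fun N => h0 N x
  obtain ⟨N, hN⟩ := hC.exists
  have hC0 : 0 ≤ C := (integral_nonneg (h0 N)).trans hN
  have h1 : ∫⁻ x, ENNReal.ofReal (f x) ∂μ ≤ ENNReal.ofReal C := by
    have h2 : ∀ x, liminf (fun N => ENNReal.ofReal (F N x)) atTop = ENNReal.ofReal (f x) := fun x =>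
      (ENNReal.tendsto_ofReal (hf x)).liminf_eq
    simp only [← h2]
    refine (lintegral_liminf_le fun N => (hm N).ennreal_ofReal).trans ?_
    refine liminf_le_of_frequently_le' (hC.mono fun N hN => ?_).frequently
    rw [← ofReal_integral_eq_lintegral_ofReal (hF N) (Eventually.of_forall (h0 N))]
    exact ENNReal.ofReal_le_ofReal hN
  have hi : Integrable f μ := ⟨hfm.aestronglyMeasurable, by
    rw [hasFiniteIntegral_iff_ofReal (Eventually.of_forall hf0)]
    exact h1.trans_lt ENNReal.ofReal_lt_top⟩
  refine ⟨hi, ?_⟩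
  rw [← ofReal_integral_eq_lintegral_ofReal hi (Eventually.of_forall hf0)] at h1
  exact (ENNReal.ofReal_le_ofReal_iff hC0).1 h1

/-- Bounded point evaluations turn a Cauchy sequence in norm into a locally uniformly Cauchy one,
whose limit is entire; Fatou's lemma then gives square integrability of the limit and convergence in
norm. -/
instance (n : ℕ) : CompleteSpace (FockSpace n) := by
  refine Metric.complete_of_cauchySeq_tendsto fun u hu => ?_
  have hunif : ∀ z : Fin n → ℂ, UniformCauchySeqOn (fun N => (u N : (Fin n → ℂ) → ℂ)) atTop
      (Metric.ball z 2) := by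
    intro z
    obtain ⟨K, hK⟩ := exists_norm_apply_le n (‖z‖ + 2)
    rw [Metric.uniformCauchySeqOn_iff]
    intro ε hε
    obtain ⟨N, hN⟩ := Metric.cauchySeq_iff.1 hu (ε / (|K| + 1)) (by positivity)
    refine ⟨N, fun m hm k hk x hx => ?_⟩
    have hx' : ‖x‖ ≤ ‖z‖ + 2 := by
      have h1 : ‖x‖ ≤ ‖z‖ + ‖x - z‖ := norm_le_norm_add_norm_sub' x z
      rw [mem_ball_iff_norm] at hx
      linarith
    have h1 := hK (u m - u k) x hx'
    have h2 := hN m hm k hk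
    rw [map_sub, Pi.sub_apply] at h1
    rw [dist_eq_norm] at h2 ⊢
    calc _ ≤ _ := h1
      _ ≤ (|K| + 1) * ‖u m - u k‖ := by
        gcongr
        linarith [le_abs_self K]
      _ < ε := by
        rw [lt_div_iff₀ (by positivity)] at h2
        linarith
  have hlim : ∀ z, ∃ l, Tendsto (fun N => u N z) atTop (𝓝 l) := fun z =>
    cauchySeq_tendsto_of_complete ((hunif z).cauchySeq (Metric.mem_ball_self two_pos))
  choose g hg using hlim
  have hgd : Differentiable ℂ g :=
    differentiable_of_uniformCauchySeqOn (fun N => (u N).differentiable) hunif hg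
  have hw := continuous_weight n
  have key : ∀ ε > 0, ∃ N, ∀ m ≥ N, Integrable (fun z => ‖g z - u m z‖ ^ 2 * weight n z) ∧
      ∫ z, ‖g z - u m z‖ ^ 2 * weight n z ≤ ε ^ 2 := by
    intro ε hε
    obtain ⟨N, hN⟩ := Metric.cauchySeq_iff.1 hu ε hε
    refine ⟨N, fun m hm => integrable_of_tendsto_of_integral_le
      (F := fun M z => ‖(u M - u m) z‖ ^ 2 * weight n z) (fun M => (u M - u m).integrable_sq)
      (fun M => Continuous.measurable
        (((u M - u m).differentiable.continuous.norm.pow 2).mul hw))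
      (fun M z => mul_nonneg (sq_nonneg _) (weight_pos n z).le) ?_ (fun z => ?_)⟩
    · filter_upwards [eventually_ge_atTop N] with M hM
      rw [← norm_sq_eq]
      have := hN M hM m hm
      rw [dist_eq_norm] at this
      exact pow_le_pow_left₀ (norm_nonneg _) this.le 2
    · simp only [map_sub, Pi.sub_apply]
      exact (((hg z).sub_const _).norm.pow 2).mul_const _
  obtain ⟨N, hN⟩ := key 1 one_pos
  -- Fatou controls only differences `g - u m`, so `g` enters the space as `d + u N`.
  set d : FockSpace n := ⟨fun z => g z - u N z, hgd.sub (u N).differentiable, (hN N le_rfl).1⟩ with hd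
  have hdz : ∀ z, d z = g z - u N z := fun z => rfl
  refine ⟨d + u N, Metric.tendsto_atTop.2 fun ε hε => ?_⟩
  obtain ⟨M, hM⟩ := key (ε / 2) (by positivity)
  refine ⟨M, fun m hm => ?_⟩
  have h1 : ‖d + u N - u m‖ ^ 2 ≤ (ε / 2) ^ 2 := by
    rw [norm_sq_eq]
    refine le_trans (le_of_eq ?_) (hM m hm).2
    congr 1
    ext z
    simp only [map_sub, map_add, Pi.sub_apply, Pi.add_apply, hdz]
    congr 3
    ring
  rw [dist_comm, dist_eq_norm]
  have := (abs_le_of_sq_le_sq' h1 (by positivity)).2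
  linarith

/-- The Hilbert basis of normalized monomials of the Segal–Bargmann space. -/
def basis (n : ℕ) : HilbertBasis (Fin n → ℕ) ℂ (FockSpace n) :=
  HilbertBasis.mkOfOrthogonalEqBot (orthonormal_unitMonomial n) (by
    rw [Submodule.eq_bot_iff]
    intro f hf
    refine Subtype.ext (funext fun z => ?_)
    have h1 : ∀ k, inner ℂ (unitMonomial k) f = 0 := fun k =>
      (Submodule.mem_orthogonal _ _).1 hf _ (Submodule.subset_span (mem_range_self k))
    -- A function orthogonal to all monomials has zero Taylor series, hence vanishes pointwise.
    have h2 := hasSum_unitMonomial f z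
    simp only [h1, zero_mul] at h2
    exact h2.unique hasSum_zero)

theorem basis_apply {n : ℕ} (k : Fin n → ℕ) : basis n k = unitMonomial k := by
  rw [basis, HilbertBasis.coe_mkOfOrthogonalEqBot]

end FockSpace

namespace ModulatedSB

variable {X : Type*} {n : ℕ} {h : X → Fin n → ℂ} (hh : Function.Injective (compMap h))

/-- The isometry `g ↦ g ∘ h`. -/
def isometryEquiv : FockSpace n ≃ₗᵢ[ℂ] ModulatedSB hh where
  toLinearEquiv := equiv hh
  norm_map' g := by
    change ‖(equiv hh).symm (equiv hh g)‖ = ‖g‖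
    rw [LinearEquiv.symm_apply_apply]

instance : CompleteSpace (ModulatedSB hh) :=
  (completeSpace_congr (e := (isometryEquiv hh).toEquiv)
    (isometryEquiv hh).isometry.isUniformEmbedding).1 inferInstance

end ModulatedSB

/-! ### Operators that are diagonal in a Hilbert basis -/

section Diagonal

variable {ι H : Type*} [NormedAddCommGroup H] [InnerProductSpace ℂ H] (b : HilbertBasis ι ℂ H)

theorem hasSum_norm_repr_sq (f : H) : HasSum (fun i => ‖b.repr f i‖ ^ 2) (‖f‖ ^ 2) := by
  have h := lp.hasSum_norm (p := 2) (by norm_num) (b.repr f)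
  simpa using h

theorem hilbertBasis_ext {f g : H} (h : ∀ i, b.repr f i = b.repr g i) : f = g :=
  b.repr.injective (lp.ext (funext h))

theorem continuous_repr_apply (i : ι) : Continuous fun f : H => b.repr f i := by
  simp only [b.repr_apply_apply]
  fun_prop

theorem repr_smul_apply (c : ℂ) (f : H) (i : ι) : b.repr (c • f) i = c * b.repr f i := by
  simp only [b.repr_apply_apply, inner_smul_right]

theorem repr_sub_apply (f g : H) (i : ι) : b.repr (f - g) i = b.repr f i - b.repr g i := by
  simp only [b.repr_apply_apply, inner_sub_right]

/-- A bounded multiplier acts on `ℓ²`. This single construction yields both the operators `U^t` and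
the resolvent. -/
theorem exists_diagonal {m : ι → ℂ} {C : ℝ} (hm : ∀ i, ‖m i‖ ≤ C) :
    ∃ D : H →L[ℂ] H, ∀ f i, b.repr (D f) i = m i * b.repr f i := by
  have hb : ∀ (a : lp (fun _ : ι => ℂ) 2) i, ‖m i * a i‖ ≤ ‖((C : ℂ) • a) i‖ := fun a i => by
    rw [lp.coeFn_smul]
    change _ ≤ ‖(C : ℂ) * a i‖
    rw [norm_mul, norm_mul, Complex.norm_real]
    exact mul_le_mul_of_nonneg_right ((hm i).trans (le_abs_self C)) (norm_nonneg _)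
  have hmem : ∀ a : lp (fun _ : ι => ℂ) 2, Memℓp (fun i => m i * a i) 2 := fun a =>
    (lp.memℓp ((C : ℂ) • a)).mono' (hb a)
  let T : lp (fun _ : ι => ℂ) 2 →ₗ[ℂ] lp (fun _ : ι => ℂ) 2 :=
    { toFun := fun a => ⟨fun i => m i * a i, hmem a⟩
      map_add' := fun a a' => lp.ext (funext fun i => by
        change m i * (a i + a' i) = m i * a i + m i * a' i
        ring)
      map_smul' := fun c a => lp.ext (funext fun i => by
        change m i * (c * a i) = c * (m i * a i)
        ring) }
  have hT : ∀ a, ‖T a‖ ≤ |C| * ‖a‖ := fun a => by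
    refine (lp.norm_mono two_ne_zero (hb a)).trans ?_
    rw [norm_smul, Complex.norm_real, Real.norm_eq_abs]
  refine ⟨(b.repr.symm.toContinuousLinearEquiv : _ →L[ℂ] H).comp
    ((T.mkContinuous |C| hT).comp (b.repr.toContinuousLinearEquiv : H →L[ℂ] _)), fun f i => ?_⟩
  change b.repr (b.repr.symm (T (b.repr f))) i = _
  rw [LinearIsometryEquiv.apply_symm_apply]
  rfl

/-- Dominated convergence for the coordinates in a Hilbert basis. -/
theorem tendsto_of_tendsto_repr {α : Type*} {l : Filter α} {x : α → H} {y w : H}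
    (hb : ∀ᶠ t in l, ∀ i, ‖b.repr (x t) i‖ ≤ ‖b.repr w i‖)
    (hx : ∀ i, Tendsto (fun t => b.repr (x t) i) l (𝓝 (b.repr y i))) : Tendsto x l (𝓝 y) := by
  rw [tendsto_iff_norm_sub_tendsto_zero]
  have h1 : Tendsto (fun t => ‖x t - y‖ ^ 2) l (𝓝 0) := by
    have h2 : ∀ t, ‖x t - y‖ ^ 2 = ∑' i, ‖b.repr (x t) i - b.repr y i‖ ^ 2 := fun t => by
      rw [← (hasSum_norm_repr_sq b (x t - y)).tsum_eq]
      simp only [repr_sub_apply]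
    simp only [h2]
    have h3 : (0 : ℝ) = ∑' i : ι, 0 := tsum_zero.symm
    rw [h3]
    refine tendsto_tsum_of_dominated_convergence
      (bound := fun i => 2 * (‖b.repr w i‖ ^ 2 + ‖b.repr y i‖ ^ 2))
      (((hasSum_norm_repr_sq b w).summable.add (hasSum_norm_repr_sq b y).summable).mul_left 2)
      (fun i => ?_) ?_
    · have := ((hx i).sub_const (b.repr y i)).norm.pow 2
      simpa using this
    · filter_upwards [hb] with t ht i
      rw [Real.norm_of_nonneg (sq_nonneg _)]
      have h4 := norm_sub_le (b.repr (x t) i) (b.repr y i)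
      have h5 := ht i
      nlinarith [norm_nonneg (b.repr (x t) i - b.repr y i), norm_nonneg (b.repr (x t) i),
        sq_nonneg (‖b.repr w i‖ - ‖b.repr y i‖), norm_nonneg (b.repr y i)]
  have h2 := h1.sqrt
  simpa [Real.sqrt_sq] using h2

end Diagonal

/-! ### Diagonal semigroups -/

theorem norm_cexp_mul_le_one {z : ℂ} (hz : z.re ≤ 0) {t : ℝ} (ht : 0 ≤ t) :
    ‖Complex.exp (z * t)‖ ≤ 1 := by
  rw [Complex.norm_exp, Real.exp_le_one_iff]
  simpa using mul_nonpos_of_nonpos_of_nonneg hz ht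

/-- Mean value inequality: on `[0, t]` the derivative has norm at most `‖z‖`, because the
exponential stays in the unit disc. It dominates the difference quotients of the semigroup uniformly
in `t`. -/
theorem norm_cexp_mul_sub_one_le {z : ℂ} (hz : z.re ≤ 0) {t : ℝ} (ht : 0 ≤ t) :
    ‖Complex.exp (z * t) - 1‖ ≤ ‖z‖ * t := by
  have hd : ∀ x ∈ Icc (0 : ℝ) t, HasDerivWithinAt (fun x : ℝ => Complex.exp (z * x))
      (Complex.exp (z * x) * z) (Icc 0 t) x := fun x _ => by
    have h1 : HasDerivAt (fun x : ℝ => z * (x : ℂ)) z x := by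
      simpa using (Complex.ofRealCLM.hasDerivAt (x := x)).const_mul z
    exact h1.cexp.hasDerivWithinAt
  have h := norm_image_sub_le_of_norm_deriv_le_segment' hd (C := ‖z‖) (fun x hx => by
    rw [norm_mul]
    exact mul_le_of_le_one_left (norm_nonneg _) (norm_cexp_mul_le_one hz hx.1)) t
    (right_mem_Icc.2 ht)
  simpa using h

theorem continuous_cexp_mul (z : ℂ) : Continuous fun t : ℝ => Complex.exp (z * t) := by fun_prop

section Semigroup

variable {ι H : Type*} [NormedAddCommGroup H] [InnerProductSpace ℂ H]

/-- `U` is the semigroup with `U^t b_i = e^{μ_i t} b_i` for the Hilbert basis `b`. -/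
structure IsDiagonalSemigroup (b : HilbertBasis ι ℂ H) (μ : ι → ℂ) (U : ℝ → H →L[ℂ] H) :
    Prop where
  re_nonpos : ∀ i, (μ i).re ≤ 0
  repr_apply : ∀ t : ℝ, 0 ≤ t → ∀ f i, b.repr (U t f) i = Complex.exp (μ i * t) * b.repr f i

theorem exists_isDiagonalSemigroup (b : HilbertBasis ι ℂ H) {μ : ι → ℂ}
    (hμ : ∀ i, (μ i).re ≤ 0) : ∃ U : ℝ → H →L[ℂ] H, IsDiagonalSemigroup b μ U := by
  have h : ∀ t : ℝ, ∃ D : H →L[ℂ] H, 0 ≤ t →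
      ∀ f i, b.repr (D f) i = Complex.exp (μ i * t) * b.repr f i := fun t => by
    by_cases ht : 0 ≤ t
    · obtain ⟨D, hD⟩ := exists_diagonal b fun i => norm_cexp_mul_le_one (hμ i) ht
      exact ⟨D, fun _ => hD⟩
    -- For negative `t` the multipliers may be unbounded; the value there is immaterial and set to
    -- `0`.
    · exact ⟨0, fun h => absurd h ht⟩
  choose U hU using h
  exact ⟨U, hμ, hU⟩

namespace IsDiagonalSemigroup

variable {b : HilbertBasis ι ℂ H} {μ : ι → ℂ} {U : ℝ → H →L[ℂ] H}

theorem continuousOn (hU : IsDiagonalSemigroup b μ U) (f : H) :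
    ContinuousOn (fun t => U t f) (Ici 0) := by
  intro t ht
  refine tendsto_of_tendsto_repr b (w := f) ?_ fun i => ?_
  · filter_upwards [self_mem_nhdsWithin] with t ht i
    rw [hU.repr_apply t ht, norm_mul]
    exact mul_le_of_le_one_left (norm_nonneg _) (norm_cexp_mul_le_one (hU.re_nonpos i) ht)
  · rw [hU.repr_apply t ht]
    refine Tendsto.congr' ?_ (((continuous_cexp_mul (μ i)).continuousWithinAt
      (s := Ici 0) (x := t)).tendsto.mul_const (b.repr f i))
    filter_upwards [self_mem_nhdsWithin] with s hs
    rw [hU.repr_apply s hs]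

theorem repr_quotient (hU : IsDiagonalSemigroup b μ U) (f : H) (i : ι) {t : ℝ} (ht : 0 ≤ t) :
    b.repr (((t⁻¹ : ℝ) : ℂ) • (U t f - f)) i =
      ((t⁻¹ : ℝ) : ℂ) * (Complex.exp (μ i * t) - 1) * b.repr f i := by
  rw [repr_smul_apply, repr_sub_apply, hU.repr_apply t ht]
  ring

theorem tendsto_repr_quotient (hU : IsDiagonalSemigroup b μ U) (f : H) (i : ι) :
    Tendsto (fun t : ℝ => b.repr (((t⁻¹ : ℝ) : ℂ) • (U t f - f)) i) (𝓝[>] 0)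
      (𝓝 (μ i * b.repr f i)) := by
  have h1 : HasDerivAt (fun x : ℝ => Complex.exp (μ i * x)) (μ i) 0 := by
    have h1 : HasDerivAt (fun x : ℝ => μ i * (x : ℂ)) (μ i) 0 := by
      simpa using (Complex.ofRealCLM.hasDerivAt (x := 0)).const_mul (μ i)
    simpa using h1.cexp
  have h2 := (hasDerivAt_iff_tendsto_slope_zero.1 h1).mono_left
    (nhdsGT_le_nhdsNE (0 : ℝ))
  refine Tendsto.congr' ?_ (h2.mul_const (b.repr f i))
  filter_upwards [self_mem_nhdsWithin] with t ht
  rw [hU.repr_quotient f i (le_of_lt ht)]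
  simp

theorem repr_of_generatesAt (hU : IsDiagonalSemigroup b μ U) {f l : H} (h : GeneratesAt U f l)
    (i : ι) : b.repr l i = μ i * b.repr f i :=
  tendsto_nhds_unique (((continuous_repr_apply b i).tendsto l).comp h)
    (hU.tendsto_repr_quotient f i)

/-- The coordinates of the difference quotients are dominated by those of `l` itself. With
`repr_of_generatesAt` this identifies the generator as multiplication by `μ` on its maximal domain.
-/
theorem generatesAt (hU : IsDiagonalSemigroup b μ U) {f l : H}
    (h : ∀ i, b.repr l i = μ i * b.repr f i) : GeneratesAt U f l := by
  refine tendsto_of_tendsto_repr b (w := l) ?_ fun i => ?_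
  · filter_upwards [self_mem_nhdsWithin] with t ht i
    have ht' : 0 < t := ht
    rw [hU.repr_quotient f i ht'.le, h, norm_mul, norm_mul, norm_mul, Complex.norm_real,
      Real.norm_of_nonneg (inv_nonneg.2 ht'.le)]
    refine mul_le_mul_of_nonneg_right ?_ (norm_nonneg _)
    rw [inv_mul_le_iff₀ ht', mul_comm t]
    exact norm_cexp_mul_sub_one_le (hU.re_nonpos i) ht'.le
  · rw [h]
    exact hU.tendsto_repr_quotient f i

theorem repr_generator (hU : IsDiagonalSemigroup b μ U) (u : (generator U).domain) (i : ι) :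
    b.repr (generator U u) i = μ i * b.repr (u : H) i :=
  hU.repr_of_generatesAt (generatesAt_choose (U := U) u) i

theorem sub_mul_repr_resolvent (hU : IsDiagonalSemigroup b μ U) {s : ℂ} {R : H →L[ℂ] H}
    (hR : IsResolvent (generator U) s R) (f : H) (i : ι) :
    (s - μ i) * b.repr (R f) i = b.repr f i := by
  obtain ⟨hf, h⟩ := hR.1 f
  have h1 := hU.repr_generator ⟨R f, hf⟩ i
  conv_rhs => rw [← h]
  rw [repr_sub_apply, repr_smul_apply, h1]
  ring

theorem sub_ne_zero (hU : IsDiagonalSemigroup b μ U) {s : ℂ} {R : H →L[ℂ] H}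
    (hR : IsResolvent (generator U) s R) (i : ι) : s - μ i ≠ 0 := fun h => by
  classical
  -- For the basis vector `b i` the right-hand side is `1`, so the factor `s - μ i` cannot vanish.
  have h1 := hU.sub_mul_repr_resolvent hR (b i) i
  rw [h, zero_mul, b.repr_self] at h1
  simp at h1

theorem repr_resolvent (hU : IsDiagonalSemigroup b μ U) {s : ℂ} {R : H →L[ℂ] H}
    (hR : IsResolvent (generator U) s R) (f : H) (i : ι) :
    b.repr (R f) i = (s - μ i)⁻¹ * b.repr f i := by
  rw [← hU.sub_mul_repr_resolvent hR f i, inv_mul_cancel_left₀ (hU.sub_ne_zero hR i)]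

theorem hasSum_resolvent (hU : IsDiagonalSemigroup b μ U) {s : ℂ} {R : H →L[ℂ] H}
    (hR : IsResolvent (generator U) s R) (f : H) :
    HasSum (fun i => (s - μ i)⁻¹ • b.repr f i • b i) (R f) := by
  have h := b.hasSum_repr (R f)
  simpa only [hU.repr_resolvent hR, mul_smul] using h

theorem re_le_norm_sub (hU : IsDiagonalSemigroup b μ U) (s : ℂ) (i : ι) : s.re ≤ ‖s - μ i‖ := by
  have h1 := Complex.re_le_norm (s - μ i)
  have h2 := hU.re_nonpos i
  rw [Complex.sub_re] at h1
  linarith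

theorem mem_opResolventSet (hU : IsDiagonalSemigroup b μ U) {s : ℂ} (hs : 0 < s.re) :
    s ∈ opResolventSet (generator U) := by
  have hne : ∀ i, s - μ i ≠ 0 := fun i =>
    norm_pos_iff.1 (hs.trans_le (hU.re_le_norm_sub s i))
  obtain ⟨R, hR⟩ := exists_diagonal b (m := fun i => (s - μ i)⁻¹) (C := s.re⁻¹) fun i => by
    rw [norm_inv]
    exact inv_anti₀ hs (hU.re_le_norm_sub s i)
  refine ⟨R, fun f => ?_, fun u => hilbertBasis_ext b fun i => ?_⟩
  -- `R f` lies in the domain because `L (R f)` can only be `s • R f - f`, and this vector has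
  -- coordinates `μ i` times those of `R f`.
  · have h1 : GeneratesAt U (R f) (s • R f - f) := hU.generatesAt fun i => by
      rw [repr_sub_apply, repr_smul_apply, hR]
      have := hne i
      field_simp
      ring
    have hf : R f ∈ (generator U).domain := ⟨_, h1⟩
    refine ⟨hf, hilbertBasis_ext b fun i => ?_⟩
    rw [repr_sub_apply, repr_smul_apply, hU.repr_generator ⟨R f, hf⟩ i, hR]
    have := hne i
    field_simp
  · rw [hR, repr_sub_apply, repr_smul_apply, hU.repr_generator, ← sub_mul,
      inv_mul_cancel_left₀ (hne i)]

theorem repr_laplace [CompleteSpace H] (hU : IsDiagonalSemigroup b μ U) (s : ℂ) (f : H) (i : ι)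
    {T : ℝ} (hT : 0 ≤ T) :
    b.repr (∫ t in (0 : ℝ)..T, Complex.exp (-s * t) • U t f) i =
      (∫ t in (0 : ℝ)..T, Complex.exp (-(s - μ i) * t)) * b.repr f i := by
  have hint : IntervalIntegrable (fun t : ℝ => Complex.exp (-s * t) • U t f) volume 0 T := by
    refine ContinuousOn.intervalIntegrable ?_
    rw [uIcc_of_le hT]
    exact (continuous_cexp_mul (-s)).continuousOn.smul
      ((hU.continuousOn f).mono fun t ht => ht.1)
  have h1 := (innerSL ℂ (b i)).intervalIntegral_comp_comm hint
  rw [b.repr_apply_apply, ← innerSL_apply_apply, ← h1, ← intervalIntegral.integral_mul_const]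
  refine intervalIntegral.integral_congr fun t ht => ?_
  rw [uIcc_of_le hT] at ht
  rw [innerSL_apply_apply, ← b.repr_apply_apply, repr_smul_apply, hU.repr_apply t ht.1, ← mul_assoc,
    ← Complex.exp_add]
  congr 2
  ring

end IsDiagonalSemigroup

/-! ### Convergence of the Laplace integral. -/

theorem intervalIntegral_cexp {z : ℂ} (hz : z ≠ 0) (T : ℝ) :
    ∫ t in (0 : ℝ)..T, Complex.exp (-z * t) = (1 - Complex.exp (-z * T)) * z⁻¹ := by
  rw [integral_exp_mul_complex (neg_ne_zero.2 hz)]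
  field_simp
  simp

/-- For `s = 0` the integral is `T`. For `s ≠ 0` with `Re s ≤ 0`, convergence would give `e^{-sT}` a
limit of modulus at least `1`; translating `T` by `a` forces `e^{-sa} = 1` for every real `a`, and
differentiating at `0` gives `s = 0`. This covers the boundary line as well. -/
theorem re_pos_of_tendsto_intervalIntegral_cexp {s c : ℂ}
    (h : Tendsto (fun T : ℝ => ∫ t in (0 : ℝ)..T, Complex.exp (-s * t)) atTop (𝓝 c)) :
    0 < s.re := by
  by_contra! hs
  rcases eq_or_ne s 0 with rfl | h0
  · simp only [neg_zero, zero_mul, Complex.exp_zero, intervalIntegral.integral_const, sub_zero,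
      Complex.real_smul, mul_one] at h
    have h1 := h.norm
    simp only [Complex.norm_real] at h1
    exact not_tendsto_nhds_of_tendsto_atTop tendsto_norm_atTop_atTop _ h1
  · simp only [intervalIntegral_cexp h0] at h
    have h1 : Tendsto (fun T : ℝ => Complex.exp (-s * T)) atTop (𝓝 (1 - c * s)) := by
      refine ((h.mul_const s).const_sub 1).congr fun T => ?_
      field_simp
      ring
    have hL : 1 - c * s ≠ 0 := by
      have h2 : 1 ≤ ‖1 - c * s‖ := by
        refine ge_of_tendsto h1.norm ?_
        filter_upwards [eventually_ge_atTop 0] with T hT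
        rw [Complex.norm_exp, Real.one_le_exp_iff]
        simpa using mul_nonpos_of_nonpos_of_nonneg hs hT
      exact norm_pos_iff.1 (one_pos.trans_le h2)
    have h3 : ∀ a : ℝ, Complex.exp (-s * a) = 1 := fun a => by
      have h4 : Tendsto (fun T : ℝ => Complex.exp (-s * (T + a : ℝ))) atTop (𝓝 (1 - c * s)) :=
        h1.comp (tendsto_atTop_add_const_right _ a tendsto_id)
      have h5 := h1.mul_const (Complex.exp (-s * a))
      have h6 := tendsto_nhds_unique h4 (h5.congr fun T => by
        rw [← Complex.exp_add]; push_cast; ring_nf)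
      exact mul_left_cancel₀ hL (by rw [← h6, mul_one])
    have h4 : HasDerivAt (fun a : ℝ => Complex.exp (-s * a)) (-s) 0 := by
      have h5 : HasDerivAt (fun x : ℝ => -s * (x : ℂ)) (-s) 0 := by
        simpa using (Complex.ofRealCLM.hasDerivAt (x := 0)).const_mul (-s)
      simpa using h5.cexp
    simp only [h3] at h4
    exact h0 (neg_eq_zero.1 (h4.unique (hasDerivAt_const _ _)))

namespace IsDiagonalSemigroup

variable {b : HilbertBasis ι ℂ H} {μ : ι → ℂ} {U : ℝ → H →L[ℂ] H} [CompleteSpace H]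

theorem laplaceConvergesTo (hU : IsDiagonalSemigroup b μ U) {s : ℂ} {R : H →L[ℂ] H}
    (hs : 0 < s.re) (hR : IsResolvent (generator U) s R) (f : H) :
    LaplaceConvergesTo U s f (R f) := by
  have hre : ∀ i, 0 < (s - μ i).re := fun i => by
    have := hU.re_nonpos i
    rw [Complex.sub_re]; linarith
  have hrepr : ∀ i, ∀ T : ℝ, 0 ≤ T → b.repr (∫ t in (0 : ℝ)..T, Complex.exp (-s * t) • U t f) i =
      (1 - Complex.exp (-(s - μ i) * T)) * b.repr (R f) i := fun i T hT => by
    rw [hU.repr_laplace s f i hT, intervalIntegral_cexp (hU.sub_ne_zero hR i),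
      hU.repr_resolvent hR, mul_assoc]
  -- The dominating vector is `2 • R f`, since `‖1 - e^{-(s-μ_i)T}‖ ≤ 2` for `T ≥ 0`.
  refine tendsto_of_tendsto_repr b (w := (2 : ℂ) • R f) ?_ fun i => ?_
  · filter_upwards [eventually_ge_atTop 0] with T hT i
    rw [hrepr i T hT, repr_smul_apply, norm_mul, norm_mul]
    refine mul_le_mul_of_nonneg_right ((norm_sub_le _ _).trans ?_) (norm_nonneg _)
    have := norm_cexp_mul_le_one (z := -(s - μ i)) (by
      rw [Complex.neg_re]; linarith [hre i]) hT
    rw [norm_one, Complex.norm_two]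
    linarith
  · have h1 : Tendsto (fun T : ℝ => Complex.exp (-(s - μ i) * T)) atTop (𝓝 0) := by
      rw [tendsto_zero_iff_norm_tendsto_zero]
      simp only [Complex.norm_exp]
      refine Real.tendsto_exp_atBot.comp ?_
      have h2 : ∀ T : ℝ, (-(s - μ i) * T).re = -(s - μ i).re * T := fun T => by simp
      simp only [h2]
      exact tendsto_id.const_mul_atTop_of_neg (neg_lt_zero.2 (hre i))
    have h2 := (h1.const_sub 1).mul_const (b.repr (R f) i)
    rw [sub_zero, one_mul] at h2
    refine h2.congr' ?_
    filter_upwards [eventually_ge_atTop 0] with T hT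
    rw [hrepr i T hT]

/-- A mode with eigenvalue `0` reduces the Laplace integral of `b i`, in its own coordinate, to the
scalar integral of `e^{-st}`, which converges only for `Re s > 0`. -/
theorem laplaceROC_eq (hU : IsDiagonalSemigroup b μ U) {i : ι} (hi : μ i = 0) :
    laplaceROC U = {s : ℂ | 0 < s.re} := by
  classical
  ext s
  refine ⟨fun h => ?_, fun hs f => ?_⟩
  · obtain ⟨l, hl⟩ := h (b i)
    refine re_pos_of_tendsto_intervalIntegral_cexp (c := b.repr l i) ?_
    refine (((continuous_repr_apply b i).tendsto l).comp hl).congr' ?_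
    filter_upwards [eventually_ge_atTop 0] with T hT
    rw [Function.comp_apply, hU.repr_laplace s (b i) i hT, hi, b.repr_self]
    simp
  · obtain ⟨R, hR⟩ := hU.mem_opResolventSet hs
    exact ⟨R f, hU.laplaceConvergesTo hs hR f⟩

end IsDiagonalSemigroup

end Semigroup

/-! ### Leading terms -/

/-- Rescaling a function near `0` picks out its leading homogeneous part. -/
theorem tendsto_rescale {V : Type*} [NormedAddCommGroup V] [NormedSpace ℝ V] {f P : V → ℂ} {d : ℕ}
    (hf : (fun y => f y - P y) =O[𝓝 0] fun y => ‖y‖ ^ (d + 1))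
    (hP : ∀ (c : ℝ) y, P (c • y) = (c : ℂ) ^ d * P y) {u : ℝ → V} {B : ℝ}
    (hu : ∀ᶠ ε in 𝓝[>] 0, ‖u ε‖ ≤ B) {p : ℂ} (hp : Tendsto (fun ε => P (u ε)) (𝓝[>] 0) (𝓝 p)) :
    Tendsto (fun ε : ℝ => ((ε : ℂ) ^ d)⁻¹ * f (ε • u ε)) (𝓝[>] 0) (𝓝 p) := by
  have hε : Tendsto (fun ε : ℝ => ε) (𝓝[>] 0) (𝓝 0) := nhdsWithin_le_nhds
  have h0 : Tendsto (fun ε => ε • u ε) (𝓝[>] 0) (𝓝 0) := by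
    rw [tendsto_zero_iff_norm_tendsto_zero]
    have h1 : Tendsto (fun ε : ℝ => |ε| * B) (𝓝[>] 0) (𝓝 0) := by
      simpa using hε.abs.mul_const B
    refine squeeze_zero' (Eventually.of_forall fun _ => norm_nonneg _) ?_ h1
    filter_upwards [hu] with ε h
    rw [norm_smul, Real.norm_eq_abs]
    exact mul_le_mul_of_nonneg_left h (abs_nonneg ε)
  obtain ⟨C, hC⟩ := hf.bound
  have h1 : Tendsto (fun ε : ℝ => ((ε : ℂ) ^ d)⁻¹ * f (ε • u ε) - P (u ε)) (𝓝[>] 0) (𝓝 0) := by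
    rw [tendsto_zero_iff_norm_tendsto_zero]
    have h2 : Tendsto (fun ε : ℝ => ε * (|C| * B ^ (d + 1))) (𝓝[>] 0) (𝓝 0) := by
      simpa using hε.mul_const (|C| * B ^ (d + 1))
    refine squeeze_zero' (Eventually.of_forall fun _ => norm_nonneg _) ?_ h2
    filter_upwards [hu, h0.eventually hC, self_mem_nhdsWithin] with ε h3 h4 h5
    have hε0 : 0 < ε := h5
    have hε1 : (ε : ℂ) ≠ 0 := by exact_mod_cast hε0.ne'
    have h6 : ((ε : ℂ) ^ d)⁻¹ * f (ε • u ε) - P (u ε) =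
        ((ε : ℂ) ^ d)⁻¹ * (f (ε • u ε) - P (ε • u ε)) := by
      rw [hP]; field_simp
    rw [h6, norm_mul, norm_inv, norm_pow, Complex.norm_real, Real.norm_of_nonneg hε0.le,
      inv_mul_le_iff₀ (by positivity)]
    refine h4.trans ?_
    rw [norm_pow, norm_norm, norm_smul, Real.norm_of_nonneg hε0.le, mul_pow]
    calc C * (ε ^ (d + 1) * ‖u ε‖ ^ (d + 1)) ≤ |C| * (ε ^ (d + 1) * B ^ (d + 1)) := by
          gcongr
          exact le_abs_self C
      _ = _ := by ring
  simpa using h1.add hp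

theorem eq_zero_of_cexp_mul_eq_one {z : ℂ} (h : ∀ t : ℝ, 0 ≤ t → Complex.exp (z * t) = 1) :
    z = 0 := by
  have h1 : HasDerivAt (fun x : ℝ => Complex.exp (z * x)) z 0 := by
    have h1 : HasDerivAt (fun x : ℝ => z * (x : ℂ)) z 0 := by
      simpa using (Complex.ofRealCLM.hasDerivAt (x := 0)).const_mul z
    simpa using h1.cexp
  have h2 : HasDerivWithinAt (fun x : ℝ => Complex.exp (z * x)) 0 (Ici 0) 0 :=
    (hasDerivWithinAt_const (0 : ℝ) (Ici 0) (1 : ℂ)).congr (fun t ht => h t ht) (h 0 le_rfl)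
  exact (uniqueDiffWithinAt_Ici (0 : ℝ)).eq_deriv _ h1.hasDerivWithinAt h2

/-- Compare Taylor coefficients on the two sides of the functional equation: substituting `a i * z
i` multiplies the `k`-th one by `∏ a i ^ k i`. -/
theorem taylor_mul_eq_zero {n : ℕ} {c : (Fin n → ℕ) → ℂ} {Q : (Fin n → ℂ) → ℂ}
    (hs : ∀ r : ℝ, 0 ≤ r → Summable fun k => ‖c k‖ * r ^ (∑ i, k i))
    (hQ : ∀ z, HasSum (fun k => c k * ∏ i, z i ^ k i) (Q z)) {a : Fin n → ℂ} {κ : ℂ}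
    (h : ∀ z, Q (fun i => a i * z i) = κ * Q z) (k : Fin n → ℕ) :
    c k * (∏ i, a i ^ k i - κ) = 0 := by
  have h1 : (fun k : Fin n → ℕ => c k * (∏ i, a i ^ k i - κ)) = 0 := by
    refine eq_zero_of_hasSum_zero one_pos ?_ fun z _ => ?_
    · refine Summable.of_nonneg_of_le (fun k => by positivity) (fun k => ?_)
        ((hs ‖a‖ (norm_nonneg a)).add ((hs 1 zero_le_one).mul_right ‖κ‖))
      rw [one_pow, mul_one, mul_one, ← mul_add, norm_mul]
      refine mul_le_mul_of_nonneg_left ((norm_sub_le _ _).trans ?_) (norm_nonneg _)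
      gcongr
      exact norm_fockMonomial_le k le_rfl
    · have h2 := (hQ fun i => a i * z i).sub ((hQ z).mul_left κ)
      rw [h, sub_self] at h2
      refine h2.congr_fun fun k => ?_
      simp only [mul_pow, Finset.prod_mul_distrib]
      ring
  exact congrFun h1 k

/-- The homogeneous polynomial on `ℂⁿ` that extends the diagonal of a real multilinear map. -/
def complexDiag {n d : ℕ}
    (q : ContinuousMultilinearMap ℝ (fun _ : Fin d => Fin n → ℝ) ℂ) (z : Fin n → ℂ) : ℂ :=
  ∑ σ : Fin d → Fin n, (∏ i, z (σ i)) * q fun i => Pi.single (σ i) 1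

theorem differentiable_complexDiag {n d : ℕ}
    (q : ContinuousMultilinearMap ℝ (fun _ : Fin d => Fin n → ℝ) ℂ) :
    Differentiable ℂ (complexDiag q) := by
  unfold complexDiag
  fun_prop

theorem complexDiag_smul {n d : ℕ}
    (q : ContinuousMultilinearMap ℝ (fun _ : Fin d => Fin n → ℝ) ℂ) (a : ℂ) (z : Fin n → ℂ) :
    complexDiag q (a • z) = a ^ d * complexDiag q z := by
  simp [complexDiag, Finset.mul_sum, Finset.prod_mul_distrib, mul_assoc]

theorem complexDiag_ofReal {n d : ℕ}
    (q : ContinuousMultilinearMap ℝ (fun _ : Fin d => Fin n → ℝ) ℂ) (v : Fin n → ℝ) :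
    complexDiag q (fun i => (v i : ℂ)) = q fun _ => v := by
  have h1 : (fun _ : Fin d => v) = fun _ => ∑ j, v j • (Pi.single j 1 : Fin n → ℝ) := by
    ext i j
    simp [Finset.sum_apply, Pi.single_apply]
  rw [h1, ContinuousMultilinearMap.map_sum]
  refine Finset.sum_congr rfl fun σ _ => ?_
  rw [ContinuousMultilinearMap.map_smul_univ, Complex.real_smul]
  push_cast
  rfl

/-- `d` is the least degree in which the Taylor series has a nonzero diagonal; all degrees zero
would make the function vanish near `x`. -/
theorem exists_leading_term {n : ℕ} {φ : (Fin n → ℝ) → ℂ} {x : Fin n → ℝ} (hφ : AnalyticAt ℝ φ x)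
    (h0 : ¬ ∀ᶠ y in 𝓝 x, φ y = 0) :
    ∃ (d : ℕ) (q : ContinuousMultilinearMap ℝ (fun _ : Fin d => Fin n → ℝ) ℂ),
      (∃ v, q (fun _ => v) ≠ 0) ∧
      (fun y => φ (x + y) - q fun _ => y) =O[𝓝 0] fun y => ‖y‖ ^ (d + 1) := by
  classical
  obtain ⟨p, hp⟩ := hφ
  have hex : ∃ d, ∃ v, p d (fun _ => v) ≠ 0 := by
    by_contra! hall
    refine h0 ?_
    have h1 : ∀ᶠ y in 𝓝 (0 : Fin n → ℝ), φ (x + y) = 0 := by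
      filter_upwards [hp.eventually_hasSum] with y hy
      simp only [hall] at hy
      exact hy.unique hasSum_zero
    have h2 : Tendsto (fun y => y - x) (𝓝 x) (𝓝 0) :=
      (continuous_id.sub continuous_const).tendsto' _ _ (by simp)
    filter_upwards [h2.eventually h1] with y hy
    simpa using hy
  refine ⟨Nat.find hex, p (Nat.find hex), Nat.find_spec hex, ?_⟩
  refine (hp.isBigO_sub_partialSum_pow (Nat.find hex + 1)).congr_left fun y => ?_
  rw [FormalMultilinearSeries.partialSum, Finset.sum_range_succ, Finset.sum_eq_zero, zero_add]
  intro k hk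
  have := Nat.find_min hex (Finset.mem_range.1 hk)
  push Not at this
  exact this y

theorem exists_leading_homogeneous {n : ℕ} {g : (Fin n → ℂ) → ℂ} (hg : Differentiable ℂ g)
    (h0 : ∃ z, g z ≠ 0) :
    ∃ (d : ℕ) (G : (Fin n → ℂ) → ℂ), Differentiable ℂ G ∧ (∃ z, G z ≠ 0) ∧
      (∀ (a : ℂ) z, G (a • z) = a ^ d * G z) ∧
      (fun z => g z - G z) =O[𝓝 0] fun z => ‖z‖ ^ (d + 1) := by
  classical
  obtain ⟨c, hc1, hc2⟩ := exists_taylor hg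
  have hex : ∃ d, ∃ k : Fin n → ℕ, ∑ i, k i = d ∧ c k ≠ 0 := by
    by_contra! hall
    obtain ⟨z, hz⟩ := h0
    have h1 := hc2 z
    simp only [fun k => hall _ k rfl, zero_mul] at h1
    exact hz (h1.unique hasSum_zero)
  set d := Nat.find hex with hd
  obtain ⟨k₀, hk₀, hck₀⟩ := Nat.find_spec hex
  have hmin : ∀ k : Fin n → ℕ, ∑ i, k i < d → c k = 0 := fun k hk => by
    have := Nat.find_min hex hk
    push Not at this
    exact this k rfl
  set s : Finset (Fin n → ℕ) := Finset.piAntidiag Finset.univ d with hs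
  have hmem : ∀ k : Fin n → ℕ, k ∈ s ↔ ∑ i, k i = d := fun k => by simp [hs]
  -- The block of Taylor terms of least degree; it is not the zero function because Taylor
  -- coefficients are unique and `c k₀ ≠ 0`.
  set G : (Fin n → ℂ) → ℂ := fun z => ∑ k ∈ s, c k * ∏ i, z i ^ k i with hG
  have hGs : ∀ z, HasSum (fun k => (if k ∈ s then c k else 0) * ∏ i, z i ^ k i) (G z) := fun z => by
    have h1 : G z = ∑ k ∈ s, (if k ∈ s then c k else 0) * ∏ i, z i ^ k i :=
      Finset.sum_congr rfl fun k hk => by rw [if_pos hk]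
    rw [h1]
    exact hasSum_sum_of_ne_finset_zero fun k hk => by rw [if_neg hk, zero_mul]
  have hle : ∀ k, ‖if k ∈ s then c k else 0‖ ≤ ‖c k‖ := fun k => by split_ifs <;> simp
  have hc1' := hc1 1 zero_le_one
  simp only [one_pow, mul_one] at hc1'
  refine ⟨d, G, by fun_prop, ?_, fun a z => ?_, ?_⟩
  · by_contra! hall
    have h1 := eq_zero_of_hasSum_zero (c := fun k => if k ∈ s then c k else 0) one_pos
      (by
        refine Summable.of_nonneg_of_le (fun k => by positivity) (fun k => ?_) hc1'
        rw [one_pow, mul_one]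
        exact hle k)
      (fun z _ => by simpa only [hall] using hGs z)
    have h2 := congrFun h1 k₀
    simp only [if_pos ((hmem k₀).2 hk₀), Pi.zero_apply] at h2
    exact hck₀ h2
  · simp only [hG, Finset.mul_sum]
    refine Finset.sum_congr rfl fun k hk => ?_
    simp only [Pi.smul_apply, smul_eq_mul, mul_pow, Finset.prod_mul_distrib,
      Finset.prod_pow_eq_pow_sum, (hmem k).1 hk]
    ring
  · refine Asymptotics.IsBigO.of_bound (∑' k, ‖c k‖) ?_
    filter_upwards [Metric.closedBall_mem_nhds (0 : Fin n → ℂ) one_pos] with z hz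
    have hz1 : ‖z‖ ≤ 1 := mem_closedBall_zero_iff.1 hz
    have h1 := (hc2 z).sub (hGs z)
    rw [norm_pow, norm_norm, ← h1.tsum_eq, ← tsum_mul_right]
    refine tsum_of_norm_bounded (hc1'.mul_right _).hasSum fun k => ?_
    rw [← sub_mul, norm_mul]
    rcases lt_trichotomy (∑ i, k i) d with h | h | h
    · rw [if_neg fun hk => h.ne ((hmem k).1 hk), hmin k h]; simp
    · rw [if_pos ((hmem k).2 h), sub_self, norm_zero, zero_mul]; positivity
    · rw [if_neg fun hk => h.ne' ((hmem k).1 hk), sub_zero]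
      refine mul_le_mul_of_nonneg_left ?_ (norm_nonneg _)
      exact (norm_fockMonomial_le k le_rfl).trans (pow_le_pow_of_le_one (norm_nonneg z) hz1 h)

/-! ### Linearization of the flow at the equilibrium -/

/-- The inclusion of `ℝⁿ` in `ℂⁿ`. -/
def complexify (n : ℕ) : (Fin n → ℝ) →L[ℝ] (Fin n → ℂ) :=
  ContinuousLinearMap.pi fun i => Complex.ofRealCLM.comp (ContinuousLinearMap.proj i)

theorem complexify_apply {n : ℕ} (v : Fin n → ℝ) : complexify n v = fun i => (v i : ℂ) := rfl

theorem norm_complexify {n : ℕ} (v : Fin n → ℝ) : ‖complexify n v‖ = ‖v‖ := by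
  simp [complexify_apply, Pi.norm_def]

/-- The Jacobian matrix as an operator on `ℂⁿ`. -/
def complexJacobian {n : ℕ} (F : (Fin n → ℝ) → (Fin n → ℝ)) (x : Fin n → ℝ) :
    (Fin n → ℂ) →L[ℂ] (Fin n → ℂ) :=
  (Matrix.toLin' ((jacobian F x).map (fun a : ℝ => (a : ℂ)))).toContinuousLinearMap

theorem complexJacobian_complexify {n : ℕ} (F : (Fin n → ℝ) → (Fin n → ℝ)) (x v : Fin n → ℝ) :
    complexJacobian F x (complexify n v) = complexify n (fderiv ℝ F x v) := by
  have h : fderiv ℝ F x v = (jacobian F x).mulVec v := by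
    rw [jacobian, LinearMap.toMatrix'_mulVec]; rfl
  ext i
  change ((jacobian F x).map (fun a : ℝ => (a : ℂ))).mulVec (complexify n v) i = _
  rw [h, complexify_apply, complexify_apply]
  simp [Matrix.mulVec, dotProduct]

/-- An eigenbasis of the Jacobian matrix. -/
theorem exists_eigenbasis {n : ℕ} {F : (Fin n → ℝ) → (Fin n → ℝ)} {x : Fin n → ℝ}
    {lam : Fin n → ℂ} (hlam : ∀ j, IsJacobianEigenvalue F x (lam j))
    (hd : Function.Injective lam) :
    ∃ E : Module.Basis (Fin n) ℂ (Fin n → ℂ), ∀ i, complexJacobian F x (E i) = lam i • E i := by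
  choose v hv using fun j => (hlam j).exists_hasEigenvector
  have hli : LinearIndependent ℂ v := Module.End.eigenvectors_linearIndependent' _ lam hd v hv
  refine ⟨Module.Basis.mk hli (hli.span_eq_top_of_card_eq_finrank' (by simp)).ge, fun i => ?_⟩
  rw [Module.Basis.mk_apply]
  exact (hv i).apply_eq_smul

theorem gronwallBound_zero_mul (K c e x : ℝ) :
    gronwallBound 0 K (c * e) x = c * gronwallBound 0 K e x := by
  unfold gronwallBound
  split_ifs <;> ring

/-- Lyapunov stability keeps the whole forward orbit in the neighbourhood where the linearization
error is at most `η` times the distance to `xs`. -/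
theorem exists_norm_sub_fderiv_le {n : ℕ} {F : (Fin n → ℝ) → (Fin n → ℝ)}
    {S : ℝ → (Fin n → ℝ) → (Fin n → ℝ)} {xs : Fin n → ℝ} (hxs : IsStableEquilibrium F S xs)
    (hF : DifferentiableAt ℝ F xs) {η : ℝ} (hη : 0 < η) :
    ∃ V ∈ 𝓝 xs, ∀ x ∈ V, ∀ t : ℝ, 0 ≤ t →
      ‖F (S t x) - fderiv ℝ F xs (S t x - xs)‖ ≤ η * ‖S t x - xs‖ := by
  have h1 := hF.hasFDerivAt.isLittleO.bound hη
  simp only [hxs.equilibrium, sub_zero] at h1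
  exact hxs.stable _ h1

/-- Rescaled trajectories near the equilibrium converge to those of the linearized system. -/
theorem tendsto_rescaled_flow {n : ℕ} {F : (Fin n → ℝ) → (Fin n → ℝ)}
    {S : ℝ → (Fin n → ℝ) → (Fin n → ℝ)} (hS : IsFlow F S) {xs : Fin n → ℝ}
    (hxs : IsStableEquilibrium F S xs) (hF : DifferentiableAt ℝ F xs) {Z : ℝ → Fin n → ℂ}
    (hZ : ∀ t, HasDerivAt Z (complexJacobian F xs (Z t)) t) {v : Fin n → ℝ}
    (hv : Z 0 = complexify n v) {T : ℝ} (hT : 0 ≤ T) :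
    Tendsto (fun ε : ℝ => complexify n (ε⁻¹ • (S T (xs + ε • v) - xs))) (𝓝[>] 0) (𝓝 (Z T)) := by
  set A := fderiv ℝ F xs with hA
  set J := complexJacobian F xs with hJ
  set K : ℝ := ‖A‖ + 1 with hK
  -- `ε * M` bounds the displacement on `[0, T]`: as `η ≤ 1`, Grönwall applies with rate `K = ‖A‖ +
  -- 1`.
  set M : ℝ := ‖v‖ * Real.exp (K * T) with hM
  have hM0 : 0 ≤ M := by positivity
  set G : ℝ := gronwallBound 0 ‖J‖ 1 T with hG
  have hG0 : 0 ≤ G := by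
    rw [hG]
    have := gronwallBound_mono le_rfl zero_le_one (norm_nonneg J) hT
    rwa [gronwallBound_x0] at this
  rw [Metric.tendsto_nhds]
  intro δ hδ
  -- Chosen so that the final error `η * M * G`, after division by `ε`, is below `δ`.
  set η : ℝ := min 1 (δ / (2 * (M * G + 1))) with hη
  have hη0 : 0 < η := lt_min one_pos (by positivity)
  obtain ⟨V, hV, hVF⟩ := exists_norm_sub_fderiv_le hxs hF hη0
  have hc : Tendsto (fun ε : ℝ => xs + ε • v) (𝓝[>] 0) (𝓝 xs) := by
    have : Continuous fun ε : ℝ => xs + ε • v := by fun_prop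
    exact (this.tendsto' 0 xs (by simp)).mono_left nhdsWithin_le_nhds
  filter_upwards [hc.eventually hV, self_mem_nhdsWithin] with ε hε hε0
  replace hε0 : 0 < ε := hε0
  have hbound := hVF _ hε
  set y : ℝ → Fin n → ℝ := fun t => S t (xs + ε • v) - xs with hy
  have hy' : ∀ t, 0 ≤ t → HasDerivWithinAt y (F (S t (xs + ε • v))) (Ici t) t := fun t ht =>
    ((hS.ode _ t ht).sub_const xs).mono (Ici_subset_Ici.2 ht)
  have hyc : ContinuousOn y (Icc 0 T) := fun t ht =>
    (((hS.ode _ t ht.1).sub_const xs).continuousWithinAt).mono Icc_subset_Ici_self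
  have hy0 : ‖y 0‖ ≤ ε * ‖v‖ := by
    simp [hy, hS.init, norm_smul, abs_of_pos hε0]
  have hyb : ∀ t ∈ Icc 0 T, ‖y t‖ ≤ ε * M := fun t ht => by
    have h1 := norm_le_gronwallBound_of_norm_deriv_right_le hyc (fun t ht => hy' t ht.1) hy0
      (K := K) (ε := 0) (fun t ht => by
        have h2 := norm_le_norm_add_norm_sub' (F (S t (xs + ε • v))) (A (y t))
        have h3 := A.le_opNorm (y t)
        have h4 := hbound t ht.1
        have h5 : η * ‖y t‖ ≤ 1 * ‖y t‖ :=
          mul_le_mul_of_nonneg_right (min_le_left _ _) (norm_nonneg _)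
        rw [add_zero, hK, add_mul]
        linarith) t ht
    rw [gronwallBound_ε0, sub_zero] at h1
    refine h1.trans ?_
    rw [hM, mul_assoc]
    have : K * t ≤ K * T := mul_le_mul_of_nonneg_left ht.2 (by positivity)
    gcongr
  -- The error solves the linearized equation up to a forcing of norm at most `η * ε * M`; a second
  -- Grönwall estimate, from zero initial value, bounds it.
  set e : ℝ → Fin n → ℂ := fun t => complexify n (y t) - ε • Z t with he
  have he' : ∀ t, 0 ≤ t → HasDerivWithinAt e
      (complexify n (F (S t (xs + ε • v))) - ε • J (Z t)) (Ici t) t := fun t ht =>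
    ((complexify n).hasFDerivAt.comp_hasDerivWithinAt t (hy' t ht)).sub
      ((hZ t).hasDerivWithinAt.const_smul ε)
  have hec : ContinuousOn e (Icc 0 T) :=
    ((complexify n).continuous.comp_continuousOn hyc).sub
      (fun t _ => ((hZ t).continuousAt.const_smul ε).continuousWithinAt)
  have he0 : ‖e 0‖ ≤ 0 := by
    simp [he, hy, hS.init, hv]
  have heb := norm_le_gronwallBound_of_norm_deriv_right_le hec (fun t ht => he' t ht.1) he0
    (K := ‖J‖) (ε := (η * (ε * M)) * 1) (fun t ht => by
      have h1 : complexify n (F (S t (xs + ε • v))) - ε • J (Z t) =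
          J (e t) + complexify n (F (S t (xs + ε • v)) - A (y t)) := by
        have h2 : J (ε • Z t) = ε • J (Z t) := by
          rw [← Complex.coe_smul, ← Complex.coe_smul, map_smul]
        have h3 : J (complexify n (y t)) = complexify n (A (y t)) :=
          complexJacobian_complexify F xs (y t)
        change _ = J (complexify n (y t) - ε • Z t) + _
        rw [map_sub J, h2, h3, (complexify n).map_sub (F (S t (xs + ε • v))) (A (y t)),
          sub_add_sub_cancel']
      rw [h1, mul_one]
      refine (norm_add_le _ _).trans (add_le_add (J.le_opNorm _) ?_)
      rw [norm_complexify]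
      exact (hbound t ht.1).trans
        (mul_le_mul_of_nonneg_left (hyb t ⟨ht.1, ht.2.le⟩) hη0.le)) T ⟨hT, le_rfl⟩
  rw [gronwallBound_zero_mul, sub_zero, ← hG] at heb
  have h1 : complexify n (ε⁻¹ • (S T (xs + ε • v) - xs)) - Z T = ε⁻¹ • e T := by
    change complexify n (ε⁻¹ • y T) - Z T = ε⁻¹ • (complexify n (y T) - ε • Z T)
    rw [map_smul, smul_sub, inv_smul_smul₀ hε0.ne']
  rw [dist_eq_norm, h1, norm_smul, norm_inv, Real.norm_of_nonneg hε0.le, inv_mul_lt_iff₀ hε0]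
  have h2 : η * (M * G + 1) ≤ δ / 2 := by
    have := min_le_right 1 (δ / (2 * (M * G + 1)))
    rw [← hη, le_div_iff₀ (by positivity)] at this
    linarith
  calc ‖e T‖ ≤ η * (ε * M) * G := heb
    _ = ε * (η * (M * G)) := by ring
    _ < ε * δ := by
      refine mul_lt_mul_of_pos_left ?_ hε0
      nlinarith

/-! ### Principal eigenfunctions have nonzero differential at the equilibrium -/

/-- The orbit of a point where `φ` is nonzero enters every neighbourhood of `xs`, and along it `φ`
only acquires nonzero exponential factors. -/
theorem IsPrincipalEigenfunction.not_eventually_zero {n : ℕ}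
    {S : ℝ → (Fin n → ℝ) → (Fin n → ℝ)} {xs : Fin n → ℝ} {μ : ℂ}
    {φ : (Fin n → ℝ) → ℂ} (hφ : IsPrincipalEigenfunction S xs μ φ) :
    ¬ ∀ᶠ y in 𝓝 xs, φ y = 0 := by
  intro h
  obtain ⟨x, hx, hne⟩ := hφ.nonzero
  have h1 : ∀ᶠ t in atTop, φ (S t x) = 0 := Tendsto.eventually hx h
  obtain ⟨t, ht, ht0⟩ := (h1.and (eventually_ge_atTop 0)).exists
  rw [hφ.eigen x hx t ht0] at ht
  exact (mul_ne_zero (Complex.exp_ne_zero _) hne) ht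

theorem cexp_lincomb {n : ℕ} (lam : Fin n → ℂ) (k : Fin n → ℕ) (t : ℝ) :
    ∏ i, Complex.exp (lam i * t) ^ k i = Complex.exp (lincomb lam k * t) := by
  simp only [← Complex.exp_nat_mul, ← Complex.exp_sum, lincomb, Finset.sum_mul, mul_assoc]

/-- Degree `0` is excluded by `Re λ_j < 0`, degree at least `2` by non-resonance, and in degree `1`
distinctness fixes the index. -/
theorem eq_single_of_lincomb_eq {n : ℕ} {lam : Fin n → ℂ} (hd : Function.Injective lam)
    (hneg : ∀ j, (lam j).re < 0) (hnr : NonResonant lam) {k : Fin n → ℕ} {j : Fin n}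
    (h : lincomb lam k = lam j) : k = Pi.single j 1 := by
  rcases lt_or_ge (∑ i, k i) 2 with h2 | h2
  · obtain ⟨i, hi⟩ : ∃ i, k i ≠ 0 := by
      by_contra! hall
      simp only [lincomb, hall, Nat.cast_zero, zero_mul, Finset.sum_const_zero] at h
      have := hneg j
      simp [← h] at this
    have h3 : k = Pi.single i 1 := by
      have h4 := Finset.add_sum_erase Finset.univ k (Finset.mem_univ i)
      have h5 : k i = 1 ∧ ∑ x ∈ Finset.univ.erase i, k x = 0 := by omega
      ext x
      rcases eq_or_ne x i with rfl | hx
      · simpa using h5.1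
      · rw [Pi.single_eq_of_ne hx]
        exact Finset.sum_eq_zero_iff.1 h5.2 x (by simp [hx])
    subst h3
    have h4 : lincomb lam (Pi.single i 1) = lam i := by
      simp [lincomb, Pi.single_apply]
    rw [hd (h4.symm.trans h)]
  · exact absurd h.symm (hnr j k h2)

/-- Near the equilibrium, a principal eigenfunction is, to first order, a nonzero multiple of a
coordinate in the eigenbasis of the Jacobian matrix. -/
theorem IsPrincipalEigenfunction.exists_linear_part {n : ℕ} {F : (Fin n → ℝ) → (Fin n → ℝ)}
    {xs : Fin n → ℝ} (hF : DifferentiableAt ℝ F xs) {S : ℝ → (Fin n → ℝ) → (Fin n → ℝ)} (hS : IsFlow F S)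
    (hxs : IsStableEquilibrium F S xs) {lam : Fin n → ℂ} (hd : Function.Injective lam)
    (hneg : ∀ j, (lam j).re < 0) (hnr : NonResonant lam)
    {E : Module.Basis (Fin n) ℂ (Fin n → ℂ)}
    (hE : ∀ i, complexJacobian F xs (E i) = lam i • E i) {j : Fin n} {φ : (Fin n → ℝ) → ℂ}
    (hφ : IsPrincipalEigenfunction S xs (lam j) φ) :
    ∃ a : ℂ, a ≠ 0 ∧
      (fun y => φ (xs + y) - a * E.equivFun (complexify n y) j) =O[𝓝 0] fun y => ‖y‖ ^ 2 := by
  obtain ⟨d, q, ⟨v₀, hv₀⟩, hq⟩ :=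
    exists_leading_term hφ.analytic hφ.not_eventually_zero
  set P : (Fin n → ℂ) → ℂ := complexDiag q with hP
  have hPd : Differentiable ℂ P := differentiable_complexDiag q
  have hPr : ∀ v, P (complexify n v) = q fun _ => v := complexDiag_ofReal q
  have hEd : Differentiable ℂ fun z : Fin n → ℂ => E.equivFun z := fun z =>
    (E.equivFun.toLinearMap.toContinuousLinearMap).differentiableAt
  have hEd' : Differentiable ℂ fun w : Fin n → ℂ => E.equivFun.symm w := fun z =>
    (E.equivFun.symm.toLinearMap.toContinuousLinearMap).differentiableAt
  set Q : (Fin n → ℂ) → ℂ := fun w => P (E.equivFun.symm w) with hQ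
  have hQd : Differentiable ℂ Q := hPd.comp hEd'
  have hqh : ∀ (c : ℝ) (y : Fin n → ℝ), q (fun _ => c • y) = (c : ℂ) ^ d * q fun _ => y := by
    intro c y
    have := q.map_smul_univ (fun _ => c) (fun _ => y)
    simpa using this
  -- the leading term is an eigenfunction of the linearized system
  have hreal : ∀ (t : ℝ), 0 ≤ t → ∀ v : Fin n → ℝ,
      Q (fun i => Complex.exp (lam i * t) * E.equivFun (complexify n v) i) =
        Complex.exp (lam j * t) * Q (E.equivFun (complexify n v)) := by
    intro t ht v
    set w := E.equivFun (complexify n v) with hw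
    have hQw : Q w = q fun _ => v := by
      simp only [hQ, hw, LinearEquiv.symm_apply_apply, hPr]
    set Z : ℝ → Fin n → ℂ := fun t => E.equivFun.symm fun i => Complex.exp (lam i * t) * w i with hZ
    have hZs : ∀ t, Z t = ∑ i, (Complex.exp (lam i * t) * w i) • E i := fun t => by
      simp only [hZ, Module.Basis.equivFun_symm_apply]
    have hZ' : ∀ t, HasDerivAt Z (complexJacobian F xs (Z t)) t := fun t => by
      have h1 : complexJacobian F xs (Z t) =
          ∑ i, (Complex.exp (lam i * t) * lam i * w i) • E i := by
        rw [hZs, map_sum]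
        refine Finset.sum_congr rfl fun i _ => ?_
        rw [map_smul, hE, smul_smul]
        congr 1; ring
      rw [h1, funext hZs]
      refine HasDerivAt.fun_sum fun i _ => HasDerivAt.smul_const ?_ _
      have h2 : HasDerivAt (fun x : ℝ => lam i * (x : ℂ)) (lam i) t := by
        simpa using (Complex.ofRealCLM.hasDerivAt (x := t)).const_mul (lam i)
      exact h2.cexp.mul_const _
    have hZ0 : Z 0 = complexify n v := by
      simp [hZ, hw]
    have hlim := tendsto_rescaled_flow hS hxs hF hZ' hZ0 ht
    set u : ℝ → Fin n → ℝ := fun ε => ε⁻¹ • (S t (xs + ε • v) - xs) with hu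
    have hb : ∀ᶠ ε in 𝓝[>] (0 : ℝ), ‖u ε‖ ≤ ‖Z t‖ + 1 := by
      filter_upwards [hlim.norm.eventually_le_const (lt_add_one _)] with ε hε
      rwa [norm_complexify] at hε
    have h1 := tendsto_rescale hq hqh hb (p := P (Z t)) (by
      simp only [← hPr]
      exact (hPd.continuous.tendsto _).comp hlim)
    have h2 := tendsto_rescale hq hqh (u := fun _ => v) (B := ‖v‖) (Eventually.of_forall fun _ => le_rfl)
      (p := q fun _ => v) tendsto_const_nhds
    have hbas : ∀ᶠ ε : ℝ in 𝓝[>] 0, xs + ε • v ∈ basin S xs := by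
      have hc : Tendsto (fun ε : ℝ => xs + ε • v) (𝓝[>] 0) (𝓝 xs) := by
        have : Continuous fun ε : ℝ => xs + ε • v := by fun_prop
        exact (this.tendsto' 0 xs (by simp)).mono_left nhdsWithin_le_nhds
      exact hc.eventually hxs.attractive
    have h3 := tendsto_nhds_unique h1 ((h2.const_mul (Complex.exp (lam j * t))).congr' (by
      filter_upwards [hbas, self_mem_nhdsWithin] with ε hε hε0
      have hε1 : ε ≠ 0 := (mem_Ioi.1 hε0).ne'
      simp only [hu]
      rw [smul_inv_smul₀ hε1, add_sub_cancel, hφ.eigen _ hε t ht]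
      ring))
    rw [hQw]
    exact h3
  -- Both sides are entire in `z`, so the identity on real vectors extends to all of `ℂⁿ`.
  have hflow : ∀ (t : ℝ), 0 ≤ t → ∀ w : Fin n → ℂ,
      Q (fun i => Complex.exp (lam i * t) * w i) = Complex.exp (lam j * t) * Q w := by
    intro t ht w
    have h1 := eq_zero_of_forall_real_pi (g := fun z : Fin n → ℂ =>
      Q (fun i => Complex.exp (lam i * t) * E.equivFun z i) -
        Complex.exp (lam j * t) * Q (E.equivFun z)) (by
          have h2 : Differentiable ℂ fun z : Fin n → ℂ =>
              (fun i => Complex.exp (lam i * t) * E.equivFun z i : Fin n → ℂ) :=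
            differentiable_pi.2 fun i => (differentiable_pi.1 hEd i).const_mul _
          exact (hQd.comp h2).sub ((hQd.comp hEd).const_mul _))
      (fun v => sub_eq_zero.2 (hreal t ht v)) (E.equivFun.symm w)
    simpa only [LinearEquiv.apply_symm_apply, sub_eq_zero] using h1
  have hhom : ∀ w : Fin n → ℂ, Q (fun i => 2 * w i) = 2 ^ d * Q w := fun w => by
    have h1 : (fun i => 2 * w i) = (2 : ℂ) • w := rfl
    simp only [hQ, h1, map_smul, hP, complexDiag_smul]
  obtain ⟨c, hc1, hc2⟩ := exists_taylor hQd
  -- Invariance under the linear flow forces `k·λ = λ_j`, and homogeneity, tested with the factor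
  -- `2`, forces `|k| = d`. Together they give `d = 1`.
  have hsupp : ∀ k, c k ≠ 0 → k = Pi.single j 1 ∧ ∑ i, k i = d := by
    intro k hk
    constructor
    · refine eq_single_of_lincomb_eq hd hneg hnr (sub_eq_zero.1 (eq_zero_of_cexp_mul_eq_one ?_))
      intro t ht
      have h1 := (mul_eq_zero.1 (taylor_mul_eq_zero hc1 hc2 (hflow t ht) k)).resolve_left hk
      rw [cexp_lincomb, sub_eq_zero] at h1
      rw [sub_mul, Complex.exp_sub, h1, div_self (Complex.exp_ne_zero _)]
    · have h1 := (mul_eq_zero.1 (taylor_mul_eq_zero hc1 hc2 hhom k)).resolve_left hk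
      rw [Finset.prod_pow_eq_pow_sum, sub_eq_zero] at h1
      have h2 : (2 : ℕ) ^ (∑ i, k i) = 2 ^ d := by exact_mod_cast h1
      exact Nat.pow_right_injective le_rfl h2
  have hQlin : ∀ w, Q w = c (Pi.single j 1) * w j := fun w => by
    refine (hc2 w).unique ?_
    have h1 := hasSum_single (f := fun k => c k * ∏ i, w i ^ k i) (Pi.single j 1) fun k hk => by
      rw [show c k = 0 from by_contra fun h => hk (hsupp k h).1, zero_mul]
    have h2 : ∏ i, w i ^ (Pi.single j 1 : Fin n → ℕ) i = w j := by
      rw [Finset.prod_eq_single j]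
      · simp
      · intro i _ hi; simp [hi]
      · simp
    rwa [h2] at h1
  have hval : ∀ v, (q fun _ => v) = c (Pi.single j 1) * E.equivFun (complexify n v) j := fun v => by
    rw [← hQlin, ← hPr]
    simp only [hQ, LinearEquiv.symm_apply_apply]
  have hc0 : c (Pi.single j 1) ≠ 0 := fun h => hv₀ (by rw [hval, h, zero_mul])
  have hd1 : d = 1 := by
    rw [← (hsupp _ hc0).2]
    simp
  refine ⟨c (Pi.single j 1), hc0, ?_⟩
  subst hd1
  simpa only [hval] using hq

/-- An entire function that vanishes on the image of `h = (φ₁, …, φₙ)` vanishes. -/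
theorem injective_compMap_conjugacy {n : ℕ} {F : (Fin n → ℝ) → (Fin n → ℝ)} {xs : Fin n → ℝ}
    (hF : DifferentiableAt ℝ F xs) {S : ℝ → (Fin n → ℝ) → (Fin n → ℝ)} (hS : IsFlow F S)
    (hxs : IsStableEquilibrium F S xs) {lam : Fin n → ℂ}
    (hlam : ∀ j, IsJacobianEigenvalue F xs (lam j)) (hd : Function.Injective lam)
    (hneg : ∀ j, (lam j).re < 0) (hnr : NonResonant lam) {φ : Fin n → (Fin n → ℝ) → ℂ}
    (hφ : ∀ j, IsPrincipalEigenfunction S xs (lam j) (φ j)) :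
    Function.Injective (compMap (conjugacy S xs φ)) := by
  obtain ⟨E, hE⟩ := exists_eigenbasis hlam hd
  choose a ha0 ha using fun j => (hφ j).exists_linear_part hF hS hxs hd hneg hnr hE
  rw [injective_iff_map_eq_zero]
  intro g hg
  by_contra hne
  have hgz : ∃ z, g z ≠ 0 := by
    by_contra! hall
    exact hne (Subtype.ext (funext hall))
  obtain ⟨d, G, hGd, ⟨z₀, hz₀⟩, hGh, hGO⟩ := exists_leading_homogeneous g.differentiable hgz
  have hreal : ∀ v : Fin n → ℝ, G (fun j => a j * E.equivFun (complexify n v) j) = 0 := by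
    intro v
    -- The values of `h` near the equilibrium, rescaled by `1 / ε`, tend to the linear parts.
    -- Rescaling `g ∘ h = 0` by `ε ^ d` therefore gives `G = 0` at the limit.
    set u : ℝ → Fin n → ℂ := fun ε j => (ε : ℂ)⁻¹ * φ j (xs + ε • v) with hu
    have hulim : Tendsto u (𝓝[>] 0) (𝓝 fun j => a j * E.equivFun (complexify n v) j) := by
      refine tendsto_pi_nhds.2 fun j => ?_
      have h1 := tendsto_rescale (d := 1) (ha j) (fun c y => by
        rw [map_smul, ← Complex.coe_smul, map_smul, Pi.smul_apply, smul_eq_mul, pow_one]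
        ring) (u := fun _ => v) (B := ‖v‖) (Eventually.of_forall fun _ => le_rfl) tendsto_const_nhds
      simpa only [pow_one] using h1
    have h1 := tendsto_rescale (V := Fin n → ℂ) hGO (fun c y => by
      rw [← Complex.coe_smul, hGh]) (u := u)
      (hulim.norm.eventually_le_const (lt_add_one _)) ((hGd.continuous.tendsto _).comp hulim)
    refine tendsto_nhds_unique h1 (tendsto_const_nhds.congr' ?_)
    have hc : Tendsto (fun ε : ℝ => xs + ε • v) (𝓝[>] 0) (𝓝 xs) := by
      have : Continuous fun ε : ℝ => xs + ε • v := by fun_prop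
      exact (this.tendsto' 0 xs (by simp)).mono_left nhdsWithin_le_nhds
    filter_upwards [hc.eventually hxs.attractive, self_mem_nhdsWithin] with ε hε hε0
    have hε1 : (ε : ℂ) ≠ 0 := by exact_mod_cast (mem_Ioi.1 hε0).ne'
    have h2 : ε • u ε = conjugacy S xs φ ⟨xs + ε • v, hε⟩ := by
      ext j
      simp [hu, conjugacy, hε1]
    have h3 : g (conjugacy S xs φ ⟨xs + ε • v, hε⟩) = 0 := congrFun hg ⟨xs + ε • v, hε⟩
    rw [h2, h3, mul_zero]
  -- After extension to complex `z`, the map `z ↦ (a j * w_j(z))` is invertible because every `a j ≠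
  -- 0`, so it reaches `z₀`.
  have h1 := eq_zero_of_forall_real_pi (g := fun z => G fun j => a j * E.equivFun z j)
    (hGd.comp (differentiable_pi.2 fun j =>
      (((ContinuousLinearMap.proj j : (Fin n → ℂ) →L[ℂ] ℂ).comp
        E.equivFun.toLinearMap.toContinuousLinearMap).differentiable).const_mul _)) hreal
    (E.equivFun.symm fun j => (a j)⁻¹ * z₀ j)
  simp only [LinearEquiv.apply_symm_apply] at h1
  refine hz₀ (Eq.trans ?_ h1)
  congr 1
  ext j
  rw [mul_inv_cancel_left₀ (ha0 j)]

/-! ### The modulated Segal–Bargmann space and the Koopman semigroup -/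

namespace ModulatedSB

variable {X : Type*} {n : ℕ} {h : X → Fin n → ℂ} (hh : Function.Injective (compMap h))

/-- The Hilbert basis of normalized monomials of `S_h`. -/
def basis : HilbertBasis (Fin n → ℕ) ℂ (ModulatedSB hh) :=
  HilbertBasis.ofRepr ((isometryEquiv hh).symm.trans (FockSpace.basis n).repr)

theorem repr_isometryEquiv (g : FockSpace n) (k : Fin n → ℕ) :
    (basis hh).repr (isometryEquiv hh g) k = inner ℂ (FockSpace.unitMonomial k) g := by
  change (FockSpace.basis n).repr ((isometryEquiv hh).symm (isometryEquiv hh g)) k = _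
  rw [LinearIsometryEquiv.symm_apply_apply, HilbertBasis.repr_apply_apply, FockSpace.basis_apply]

theorem basis_apply (k : Fin n → ℕ) :
    basis hh k = isometryEquiv hh (FockSpace.unitMonomial k) := by
  classical
  rw [← HilbertBasis.repr_symm_single]
  change isometryEquiv hh ((FockSpace.basis n).repr.symm _) = _
  rw [HilbertBasis.repr_symm_single, FockSpace.basis_apply]

theorem monomial_eq (k : Fin n → ℕ) : monomial hh k = isometryEquiv hh (fockMonomial k) := rfl

theorem inner_monomial_isometryEquiv (k : Fin n → ℕ) (g : FockSpace n) :
    inner ℂ (monomial hh k) (isometryEquiv hh g) = inner ℂ (fockMonomial k) g := by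
  rw [monomial_eq, LinearIsometryEquiv.inner_map_map]

theorem norm_monomial (k : Fin n → ℕ) : ‖monomial hh k‖ = ‖fockMonomial k‖ := by
  rw [monomial_eq, LinearIsometryEquiv.norm_map]

theorem proj_apply (k : Fin n → ℕ) (f : ModulatedSB hh) :
    proj hh k f = (inner ℂ (monomial hh k) f / (‖fockMonomial k‖ : ℂ) ^ 2) • monomial hh k := by
  rw [proj, Submodule.starProjection_singleton, norm_monomial]
  push_cast
  rfl

theorem proj_eq_repr_smul (k : Fin n → ℕ) (f : ModulatedSB hh) :
    proj hh k f = (basis hh).repr f k • basis hh k := by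
  have h0 : (‖fockMonomial k‖ : ℂ) ≠ 0 := by exact_mod_cast (FockSpace.norm_fockMonomial_pos k).ne'
  have hu : basis hh k = ((‖fockMonomial k‖⁻¹ : ℝ) : ℂ) • monomial hh k := by
    rw [basis_apply, monomial_eq, FockSpace.unitMonomial, map_smul]
  rw [HilbertBasis.repr_apply_apply, hu, inner_smul_left, smul_smul, proj_apply]
  congr 1
  simp only [Complex.conj_ofReal]
  push_cast
  field_simp

theorem hasSum_apply (g : FockSpace n) (x : X) :
    HasSum (fun k => (basis hh).repr (isometryEquiv hh g) k * FockSpace.unitMonomial k (h x))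
      (isometryEquiv hh g x) := by
  simp only [repr_isometryEquiv]
  exact FockSpace.hasSum_unitMonomial g (h x)

theorem exists_expansion (f : ModulatedSB hh) : ∃ V : (Fin n → ℕ) → ℂ,
    (∀ k, proj hh k f = V k • monomial hh k) ∧ HasSum (fun k => V k • monomial hh k) f ∧
      ∀ x : X, HasSum (fun k : Fin n → ℕ => V k * ∏ j, h x j ^ k j) (f x) := by
  refine ⟨fun k => inner ℂ (monomial hh k) f / (‖fockMonomial k‖ : ℂ) ^ 2,
    fun k => proj_apply hh k f, ?_, fun x => ?_⟩
  · simp only [← proj_apply, proj_eq_repr_smul]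
    exact (basis hh).hasSum_repr f
  · obtain ⟨g, rfl⟩ := (isometryEquiv hh).surjective f
    simp only [inner_monomial_isometryEquiv]
    exact FockSpace.hasSum_inner_monomial g (h x)

end ModulatedSB

/-! ### The diagonal semigroup is the Koopman semigroup. -/

theorem re_lincomb_nonpos {n : ℕ} {lam : Fin n → ℂ} (hneg : ∀ j, (lam j).re < 0)
    (k : Fin n → ℕ) : (lincomb lam k).re ≤ 0 := by
  rw [lincomb, Complex.re_sum]
  refine Finset.sum_nonpos fun i _ => ?_
  simpa using mul_nonpos_of_nonneg_of_nonpos (Nat.cast_nonneg (k i)) (hneg i).le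

theorem lincomb_zero {n : ℕ} (lam : Fin n → ℂ) : lincomb lam 0 = 0 := by
  simp [lincomb]

theorem unitMonomial_mul {n : ℕ} (k : Fin n → ℕ) (a z : Fin n → ℂ) :
    FockSpace.unitMonomial k (fun i => a i * z i) =
      (∏ i, a i ^ k i) * FockSpace.unitMonomial k z := by
  simp only [FockSpace.unitMonomial, map_smul, Pi.smul_apply, fockMonomial_apply, mul_pow,
    Finset.prod_mul_distrib, smul_eq_mul]
  ring

/-- Pointwise comparison of expansions: evaluating the `k`-th monomial at `h (S^t x)` instead of `h
x` produces exactly the multiplier `e^{μ_k t}`. -/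
theorem isKoopmanSemigroup {n : ℕ} {F : (Fin n → ℝ) → (Fin n → ℝ)}
    {S : ℝ → (Fin n → ℝ) → (Fin n → ℝ)} (hS : IsFlow F S) {xs : Fin n → ℝ} {lam : Fin n → ℂ}
    {φ : Fin n → (Fin n → ℝ) → ℂ} (hφ : ∀ j, IsPrincipalEigenfunction S xs (lam j) (φ j))
    (hh : Function.Injective (compMap (conjugacy S xs φ)))
    {U : ℝ → ModulatedSB hh →L[ℂ] ModulatedSB hh}
    (hU : IsDiagonalSemigroup (ModulatedSB.basis hh) (lincomb lam) U) :
    IsKoopmanSemigroup hS xs hh U := by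
  refine ⟨fun t ht f x => ?_, hU.continuousOn⟩
  obtain ⟨g, rfl⟩ := (ModulatedSB.isometryEquiv hh).surjective f
  obtain ⟨g', hg'⟩ := (ModulatedSB.isometryEquiv hh).surjective
    (U t (ModulatedSB.isometryEquiv hh g))
  have h1 := ModulatedSB.hasSum_apply hh g' x
  rw [hg'] at h1
  refine h1.unique ((ModulatedSB.hasSum_apply hh g (flowOnBasin hS xs t ht x)).congr_fun fun k => ?_)
  have h2 : conjugacy S xs φ (flowOnBasin hS xs t ht x) =
      fun j => Complex.exp (lam j * t) * conjugacy S xs φ x j :=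
    funext fun j => (hφ j).eigen x x.2 t ht
  rw [hU.repr_apply t ht, h2, unitMonomial_mul, cexp_lincomb]
  ring

end KoopmanResolvent

end

theorem theorem2 {n : ℕ} (F : (Fin n → ℝ) → (Fin n → ℝ)) (hF : AnalyticOnNhd ℝ F Set.univ)
    (S : ℝ → (Fin n → ℝ) → (Fin n → ℝ)) (hS : IsFlow F S)
    (xs : Fin n → ℝ) (hxs : IsStableEquilibrium F S xs)
    (lam : Fin n → ℂ) (hlam : ∀ j, IsJacobianEigenvalue F xs (lam j))
    (hdistinct : Function.Injective lam) (hneg : ∀ j, (lam j).re < 0)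
    (hnonres : NonResonant lam)
    (φ : Fin n → (Fin n → ℝ) → ℂ)
    (hφ : ∀ j, IsPrincipalEigenfunction S xs (lam j) (φ j)) :
    -- every element of `S_h` is `g ∘ h` for only one `g`, so that its norm is well defined
    ∃ hh : Function.Injective (compMap (conjugacy S xs φ)),
      CompleteSpace (ModulatedSB hh) ∧
      -- the orthogonal projections `P_k` give the expansion in the eigenfunction monomials
      (∀ k l : Fin n → ℕ, k ≠ l → inner ℂ (monomial hh k) (monomial hh l) = 0) ∧
      (∀ f : ModulatedSB hh, ∃ V : (Fin n → ℕ) → ℂ,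
        (∀ k, proj hh k f = V k • monomial hh k) ∧
        HasSum (fun k => V k • monomial hh k) f ∧
        ∀ x : basin S xs, HasSum (fun k : Fin n → ℕ => V k * ∏ j, φ j x ^ k j) (f x)) ∧
      -- the Koopman semigroup on `S_h` exists
      ∃ U : ℝ → ModulatedSB hh →L[ℂ] ModulatedSB hh,
        IsKoopmanSemigroup hS xs hh U ∧
        -- the half-plane lies in the resolvent set of the generator
        (∀ s : ℂ, 0 < s.re → s ∈ opResolventSet (generator U)) ∧
        -- the expansion of the resolvent (no denominator vanishes on the resolvent set)
        (∀ (s : ℂ) (R : ModulatedSB hh →L[ℂ] ModulatedSB hh),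
          IsResolvent (generator U) s R →
            (∀ k : Fin n → ℕ, s - lincomb lam k ≠ 0) ∧
            ∀ f, HasSum (fun k : Fin n → ℕ => (s - lincomb lam k)⁻¹ • proj hh k f) (R f)) ∧
        -- the region of convergence of the Laplace integral of the semigroup, and its value
        laplaceROC U = {s : ℂ | 0 < s.re} ∧
        (∀ (s : ℂ) (R : ModulatedSB hh →L[ℂ] ModulatedSB hh),
          0 < s.re → IsResolvent (generator U) s R →
            ∀ f, LaplaceConvergesTo U s f (R f)) := by
  have hh := injective_compMap_conjugacy (hF xs (Set.mem_univ xs)).differentiableAt hS hxs hlam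
    hdistinct hneg hnonres hφ
  obtain ⟨U, hU⟩ := exists_isDiagonalSemigroup (ModulatedSB.basis hh)
    (re_lincomb_nonpos hneg)
  -- The zero mode used for the region of convergence is `k = 0`, the constant function `1`.
  refine ⟨hh, inferInstance, fun k l hkl => ?_, ModulatedSB.exists_expansion hh, U,
    isKoopmanSemigroup hS hφ hh hU, fun s hs => hU.mem_opResolventSet hs,
    fun s R hR => ⟨hU.sub_ne_zero hR, fun f => ?_⟩, hU.laplaceROC_eq (lincomb_zero lam),
    fun s R hs hR => hU.laplaceConvergesTo hs hR⟩
  · exact (ModulatedSB.inner_monomial_isometryEquiv hh k _).trans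
      (FockSpace.inner_monomial_of_ne hkl)
  · simpa only [ModulatedSB.proj_eq_repr_smul] using hU.hasSum_resolvent hR f
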